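/- Setting (indices cyclic in $\{1,2,3,4\}$). A skew Kokotsakis mesh is a $3\times 3$ quad mesh with rigid, possibly non-planar faces joined by hinges; its motion depends only on the planar angles $\alpha_i,\beta_i,\gamma_i,\delta_i\in(0,\pi)$ at the four inner vertices $A_1,\dots,A_4$ and on the constant oriented dihedral angles $\tau_i$ (of the central tetrahedron) and $\zeta_i$ (of the side tetrahedra) in $(-\pi,\pi)$ along the edges $A_{i-1}A_i$. Let $Q_i$ be the spherical quadrilateral with consecutive side lengths $\alpha_i,\beta_i,\gamma_i,\delta_i$. A real configuration consists of angles $\varphi_1,\dots,\varphi_4\in\mathbb R/2\pi\mathbb Z$ such that, with $\psi_i=\varphi_i+\tau_i+\zeta_i$, the quadrilaterals $Q_1,Q_2,Q_3,Q_4$ close up with oriented exterior angles $\varphi_2,\psi_2,\varphi_4,\psi_4$, respectively, at the vertex between $\alpha_i$ and $\delta_i$, and $\varphi_1,\psi_3,\varphi_3,\psi_1$, respectively, at the vertex between $\gamma_i$ and $\delta_i$. The mesh is flexible if it has a one-parameter family (a continuous injective path) of real configurations. Put $\lambda_i=\frac{\tan\delta_i+\tan\alpha_i}{\tan\delta_i-\tan\alpha_i}$,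 or $\lambda_i=\frac{\cos\beta_i+\cos\gamma_i}{\cos\beta_i-\cos\gamma_i}$ if $\alpha_i=\delta_i=\frac\pi2$; $\mu_i=\frac{\tan\delta_i+\tan\gamma_i}{\tan\delta_i-\tan\gamma_i}$, or $\mu_i=\frac{\cos\beta_i+\cos\alpha_i}{\cos\beta_i-\cos\alpha_i}$ if $\gamma_i=\delta_i=\frac\pi2$ (where one tangent is infinite, the quotient means $\frac{\sin(\delta_i+\alpha_i)}{\sin(\delta_i-\alpha_i)}$, resp. $\frac{\sin(\delta_i+\gamma_i)}{\sin(\delta_i-\gamma_i)}$); and $\nu_i=\frac{(\lambda_i-1)(\mu_i-1)}{\cos\delta_i}$ if $\delta_i\ne\frac\pi2$, $\nu_i=\frac{4\sin\alpha_i}{\cos\beta_i-\cos\alpha_i}$ if $\delta_i=\gamma_i=\frac\pi2$, $\nu_i=\frac{4\sin\gamma_i}{\cos\beta_i-\cos\gamma_i}$ if $\delta_i=\alpha_i=\frac\pi2$. Put $F_i=\tan\frac{\tau_i+\zeta_i}2$ and $t_i=\frac{2F_i}{1-F_i^2}=\tan(\tau_i+\zeta_i)$, both in $\mathbb R\cup\{\infty\}$.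 Let $k_1,k_2,k_3,k_4$ be $-\mu_4,-\lambda_2,-\mu_2,-\lambda_4$, respectively, if the corresponding $F_i$ is $\infty$, and $k_i=1$ otherwise. The mesh is of elliptic orthodiagonal involutive type if: (1) for all $i$, $\cos\alpha_i\cos\gamma_i=\cos\beta_i\cos\delta_i$, and $\alpha_i\pm\beta_i\pm\gamma_i\pm\delta_i\not\equiv 0 \pmod{2\pi}$ for all choices of signs; (2) for each $i$, with $(a,b)=(\lambda_{i-1},\lambda_i)$ for $i=2,4$ and $(a,b)=(\mu_{i-1},\mu_i)$ for $i=1,3$: $a=b$ if $F_i=0$; $a=b=-1$ if $F_i\in\mathbb R\setminus\{0\}$; $a=1/b$ if $F_i=\infty$; (3) all $2\times2$ minors $p_{ij}$ of the following matrix vanish, where $k=k_2k_3$ and $k'=k_4k_1$ (both equal to $1$ if no $F_i$ is infinite): $$\begin{pmatrix}2(4kt_2+\nu_2t_3)&4(4kt_2t_3-\nu_2)&\nu_1(4k-\nu_2t_2t_3)&2\nu_1(\nu_2t_2+4kt_3)\\2(\nu_4t_1+4k't_4)&\nu_3(4k'-\nu_4t_1t_4)&4(4k't_1t_4-\nu_4)&2\nu_3(4k't_1+\nu_4t_4)\end{pmatrix};$$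 if some $t_i=\infty$, the rows are first cleared of denominators, writing $t_i=\frac{\sin(\tau_i+\zeta_i)}{\cos(\tau_i+\zeta_i)}$. The local existence conditions hold if for every $i$ either $\lambda_i<0$ or $\mu_i<0$, or $\lambda_i>0$, $\mu_i>0$ and $\frac{\nu_i^2}{\lambda_i\mu_i}>16$. **Theorem (Global existence).** A skew Kokotsakis mesh of elliptic orthodiagonal involutive type that satisfies the local existence conditions is flexible if and only if one of the following holds: - $\lambda_i<0$ and $\mu_i>0$ for all $i$, and either $t_2=0$ or $16\sqrt{\mu_1\mu_2}-|\nu_1\nu_2|<\frac{4|\nu_2|\sqrt{\mu_1}+4|\nu_1|\sqrt{\mu_2}}{|t_2|}$; - $\lambda_i>0$ and $\mu_i<0$ for all $i$, and either $t_3=0$ or $16\sqrt{\lambda_2\lambda_3}-|\nu_2\nu_3|<\frac{4|\nu_3|\sqrt{\lambda_2}+4|\nu_2|\sqrt{\lambda_3}}{|t_3|}$; - the $\lambda_i,\mu_i$ have any other combination of signs. (For $t_2=\infty$ or $t_3=\infty$ the right-hand side of the corresponding inequality is $0$.) -/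

import Mathlib

open Real

/-- A skew Kokotsakis mesh, recorded through the data on which its motion depends: the constant
planar angles `α i, β i, γ i, δ i` at the inner vertices `A 1, …, A 4`, and the constant oriented
dihedral angles `τ i` of the central tetrahedron and `ζ i` of the side tetrahedra along the edges
`A (i-1) A i`.  Indices are cyclic; the label `4` is the same as `0`. -/
structure SkewKokotsakisMesh where
  α : ZMod 4 → ℝ
  β : ZMod 4 → ℝ
  γ : ZMod 4 → ℝ
  δ : ZMod 4 → ℝ
  τ : ZMod 4 → ℝ
  ζ : ZMod 4 → ℝ
  α_mem : ∀ i, α i ∈ Set.Ioo 0 π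
  β_mem : ∀ i, β i ∈ Set.Ioo 0 π
  γ_mem : ∀ i, γ i ∈ Set.Ioo 0 π
  δ_mem : ∀ i, δ i ∈ Set.Ioo 0 π
  τ_mem : ∀ i, τ i ∈ Set.Ioo (-π) π
  ζ_mem : ∀ i, ζ i ∈ Set.Ioo (-π) π

/-! ### Spherical four-bar linkages

A spherical quadrilateral with consecutive side lengths `α, β, γ, δ` is placed on the unit sphere
with its side `δ` from `(0, 0, 1)` (the vertex `γδ`) to `(sin δ, 0, cos δ)` (the vertex `αδ`). -/

/-- The vertex `βγ`: at distance `γ` from the vertex `γδ`, where the interior angle (counted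
from the side `δ`, positive towards the second coordinate) is `π - φ`. -/
noncomputable def vertexBetaGamma (γ : ℝ) (φ : Real.Angle) : EuclideanSpace ℝ (Fin 3) :=
  !₂[-(φ.cos * sin γ), φ.sin * sin γ, cos γ]

/-- The vertex `αβ`: at distance `α` from the vertex `αδ`, where the interior angle (counted
from the side `δ`, positive towards the second coordinate) is `π - χ`.  The unit tangent vector
at the vertex `αδ` along the side `δ` is `(-cos δ, 0, sin δ)`. -/
noncomputable def vertexAlphaBeta (α δ : ℝ) (χ : Real.Angle) : EuclideanSpace ℝ (Fin 3) :=
  cos α • !₂[sin δ, 0, cos δ]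
    + sin α • ((-χ.cos) • !₂[-cos δ, 0, sin δ] + χ.sin • !₂[0, 1, 0])

/-- The configuration space of the spherical quadrilateral with side lengths `α, β, γ, δ`: the
exterior angles `χ` at the vertex `αδ` and `φ` at the vertex `γδ` occur together iff the remaining
two vertices are at spherical distance `β`. -/
def QuadCloses (α β γ δ : ℝ) (χ φ : Real.Angle) : Prop :=
  InnerProductGeometry.angle (vertexAlphaBeta α δ χ) (vertexBetaGamma γ φ) = β

/-! ### Involution factors -/

/-- The involution factor `(tan δ + tan a) / (tan δ - tan a)` of an orthodiagonal quadrilateral at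
the vertex between the sides `δ` and `a`, where `b` is the side opposite to `δ` and `c` the side
opposite to `a`.  The quotient is written as `sin (δ + a) / sin (δ - a)`, which is its value also
if exactly one of the two tangents is infinite. -/
noncomputable def involutionFactor (a b c δ : ℝ) : ℝ :=
  if a = π / 2 ∧ δ = π / 2 then (cos b + cos c) / (cos b - cos c)
  else sin (δ + a) / sin (δ - a)

/-- The parameter `ν` of an elliptic orthodiagonal quadrilateral.  For `δ = γ = π / 2` the product
`2 * (μ - 1) * tan α` is `4 * sin α / (cos β - cos α)`; in this form it keeps its value at
`α = π / 2`.  The case `δ = α = π / 2` is analogous. -/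
noncomputable def nuFactor (α β γ δ : ℝ) : ℝ :=
  if δ = π / 2 then
    if γ = π / 2 then 4 * sin α / (cos β - cos α) else 4 * sin γ / (cos β - cos γ)
  else (involutionFactor α β γ δ - 1) * (involutionFactor γ β α δ - 1) / cos δ

/-- The condition on the involution factors `a, b` of two quadrilaterals coupled with the
parameter `F ∈ ℝ ∪ {∞}`. -/
def InvolutiveCoupling (F : OnePoint ℝ) (a b : ℝ) : Prop :=
  (F = ((0 : ℝ) : OnePoint ℝ) → a = b) ∧
  (F ≠ ((0 : ℝ) : OnePoint ℝ) → F ≠ OnePoint.infty → a = -1 ∧ b = -1) ∧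
  (F = OnePoint.infty → a = 1 / b)

open Classical in
/-- The multiplier `k` of a coupling with parameter `F`: equal to `1` unless `F = ∞`. -/
noncomputable def couplingMultiplier (F : OnePoint ℝ) (b : ℝ) : ℝ :=
  if F = OnePoint.infty then -b else 1

namespace SkewKokotsakisMesh

variable (M : SkewKokotsakisMesh)

/-! ### Configurations and flexibility -/

/-- The other variable dihedral angle at the edge `A (i-1) A i`: `ψ i = φ i + τ i + ζ i`. -/
noncomputable def psi (φ : ZMod 4 → Real.Angle) (i : ZMod 4) : Real.Angle :=
  φ i + ((M.τ i + M.ζ i : ℝ) : Real.Angle)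

/-- The angles `φ 1, …, φ 4` form a real configuration of the mesh: all four coupled spherical
quadrilaterals close up. -/
def IsConfiguration (φ : ZMod 4 → Real.Angle) : Prop :=
  QuadCloses (M.α 1) (M.β 1) (M.γ 1) (M.δ 1) (φ 2) (φ 1) ∧
  QuadCloses (M.α 2) (M.β 2) (M.γ 2) (M.δ 2) (M.psi φ 2) (M.psi φ 3) ∧
  QuadCloses (M.α 3) (M.β 3) (M.γ 3) (M.δ 3) (φ 4) (φ 3) ∧
  QuadCloses (M.α 4) (M.β 4) (M.γ 4) (M.δ 4) (M.psi φ 4) (M.psi φ 1)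

/-- The mesh has a one-parameter family of real configurations. -/
def IsFlexible : Prop :=
  ∃ φ : unitInterval → ZMod 4 → Real.Angle,
    Continuous φ ∧ Function.Injective φ ∧ ∀ u, M.IsConfiguration (φ u)

/-! ### The parameters of the mesh -/

/-- The involution factor `λ i` at the vertex `αδ` of the `i`-th quadrilateral. -/
noncomputable def lam (i : ZMod 4) : ℝ := involutionFactor (M.α i) (M.β i) (M.γ i) (M.δ i)

/-- The involution factor `μ i` at the vertex `γδ` of the `i`-th quadrilateral. -/
noncomputable def mu (i : ZMod 4) : ℝ := involutionFactor (M.γ i) (M.β i) (M.α i) (M.δ i)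

/-- The parameter `ν i` of the `i`-th quadrilateral. -/
noncomputable def nu (i : ZMod 4) : ℝ := nuFactor (M.α i) (M.β i) (M.γ i) (M.δ i)

open Classical in
/-- `F i = tan ((τ i + ζ i) / 2)`, an element of `ℝ ∪ {∞}`. -/
noncomputable def F (i : ZMod 4) : OnePoint ℝ :=
  if cos ((M.τ i + M.ζ i) / 2) = 0 then OnePoint.infty
  else ((tan ((M.τ i + M.ζ i) / 2) : ℝ) : OnePoint ℝ)

/-- Numerator of `t i = 2 F i / (1 - F i ^ 2) = tan (τ i + ζ i)`, an element of `ℝ ∪ {∞}`. -/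
noncomputable def tNum (i : ZMod 4) : ℝ := sin (M.τ i + M.ζ i)

/-- Denominator of `t i`; it vanishes iff `F i ^ 2 = 1`, that is, `t i = ∞`. -/
noncomputable def tDen (i : ZMod 4) : ℝ := cos (M.τ i + M.ζ i)

/-- The multipliers `k i`. If no `F i` is infinite, they are all equal to `1`. -/
noncomputable def k1 : ℝ := couplingMultiplier (M.F 1) (M.mu 4)
noncomputable def k2 : ℝ := couplingMultiplier (M.F 2) (M.lam 2)
noncomputable def k3 : ℝ := couplingMultiplier (M.F 3) (M.mu 2)
noncomputable def k4 : ℝ := couplingMultiplier (M.F 4) (M.lam 4)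

/-- The matrix `N`: its rows hold the coefficients of `w₁ w₃, w₁, w₃, 1` in
`k₂ k₃ (4 t₂ w₁ + 2 ν₁) (2 w₃ + 4 t₃) = ν₂ (2 w₁ - ν₁ t₂) (2 - t₃ w₃)` and in
`k₄ k₁ (4 t₄ w₃ + 2 ν₃) (2 w₁ + 4 t₁) = ν₄ (2 w₃ - ν₃ t₄) (2 - t₁ w₁)`.
With `t i = tNum i / tDen i`, the rows are cleared of the denominators `tDen 2 * tDen 3` and
`tDen 4 * tDen 1`, so that `t i = ∞` is allowed. -/
noncomputable def N : Matrix (Fin 2) (Fin 4) ℝ :=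
  !![2 * (4 * (M.k2 * M.k3) * M.tNum 2 * M.tDen 3 + M.nu 2 * M.tDen 2 * M.tNum 3),
     4 * (4 * (M.k2 * M.k3) * M.tNum 2 * M.tNum 3 - M.nu 2 * M.tDen 2 * M.tDen 3),
     M.nu 1 * (4 * (M.k2 * M.k3) * M.tDen 2 * M.tDen 3 - M.nu 2 * M.tNum 2 * M.tNum 3),
     2 * M.nu 1 * (M.nu 2 * M.tNum 2 * M.tDen 3 + 4 * (M.k2 * M.k3) * M.tDen 2 * M.tNum 3);
     2 * (M.nu 4 * M.tNum 1 * M.tDen 4 + 4 * (M.k4 * M.k1) * M.tDen 1 * M.tNum 4),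
     M.nu 3 * (4 * (M.k4 * M.k1) * M.tDen 1 * M.tDen 4 - M.nu 4 * M.tNum 1 * M.tNum 4),
     4 * (4 * (M.k4 * M.k1) * M.tNum 1 * M.tNum 4 - M.nu 4 * M.tDen 1 * M.tDen 4),
     2 * M.nu 3 * (4 * (M.k4 * M.k1) * M.tNum 1 * M.tDen 4 + M.nu 4 * M.tDen 1 * M.tNum 4)]

/-- The `2 × 2` minor of `N` formed by the columns `i` and `j`. -/
noncomputable def p (i j : Fin 4) : ℝ := M.N 0 i * M.N 1 j - M.N 0 j * M.N 1 i

/-! ### The elliptic orthodiagonal involutive type -/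

/-- All quadrilaterals have orthogonal diagonals. -/
def IsOrthodiagonal : Prop :=
  ∀ i, cos (M.α i) * cos (M.γ i) = cos (M.β i) * cos (M.δ i)

/-- No combination `α i ± β i ± γ i ± δ i` is an integer multiple of `2π`. -/
def IsElliptic : Prop :=
  ∀ i, ∀ e₁ e₂ e₃ : ℝ, (e₁ = 1 ∨ e₁ = -1) → (e₂ = 1 ∨ e₂ = -1) → (e₃ = 1 ∨ e₃ = -1) →
    ∀ m : ℤ, M.α i + e₁ * M.β i + e₂ * M.γ i + e₃ * M.δ i ≠ 2 * π * m

/-- All four couplings of adjacent quadrilaterals are involutive. -/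
def IsInvolutive : Prop :=
  InvolutiveCoupling (M.F 1) (M.mu 4) (M.mu 1) ∧
  InvolutiveCoupling (M.F 2) (M.lam 1) (M.lam 2) ∧
  InvolutiveCoupling (M.F 3) (M.mu 2) (M.mu 3) ∧
  InvolutiveCoupling (M.F 4) (M.lam 3) (M.lam 4)

/-- The elliptic orthodiagonal involutive type. -/
structure IsEllipticOI : Prop where
  orthodiagonal : M.IsOrthodiagonal
  elliptic : M.IsElliptic
  involutive : M.IsInvolutive
  minors : ∀ i j : Fin 4, i < j → M.p i j = 0

/-- The conditions for local existence, for every quadrilateral. -/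
def LocalExistence : Prop :=
  ∀ i, (M.lam i < 0 ∨ M.mu i < 0) ∨
    (0 < M.lam i ∧ 0 < M.mu i ∧ 16 < M.nu i ^ 2 / (M.lam i * M.mu i))

end SkewKokotsakisMesh

/-! With `x = tan (θ / 2)`, an elliptic orthodiagonal quadrilateral closes iff `(x + λ / x) (y + μ /
y) = ν`. In the coordinates `w = (x + T / x) / 2`, with `T = λ` or `T = μ`, this is a projective
isomorphism between two projective lines. Passing from `φ i` to `ψ i` is projective too
(`InvolutiveCoupling.rotation`). The mesh is thus a cycle of four projective relations. The
vanishing minors say that the two ways around the cycle agree (`IsEllipticOI.relation_of_relation`),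
so every value of `w` at one edge extends to a solution of all four relations.

What remains is reality. A real `x` exists over `w` iff `w ^ 2 ≥ T`: no condition for `T < 0`, an
arc around infinity for `T > 0`. The thresholds at the four edges are `mu 1`, `lam 1`, `mu 3`, `lam
3`. A coupling multiplies a threshold by a square, so signs persist, and a positive threshold makes
the coupling a mere scaling of `w`. A point strictly above all thresholds moves in a one-parameter
family (`IsEllipticOI.isFlexible_of_point`).

Between adjacent edges with positive thresholds the relation is `w w' = C`, and local existence says
`T T' < C ^ 2`. A value slightly above `T` therefore satisfies both neighbors, which settles every
pattern where a positive threshold faces a negative one. If all four are positive, the compatibility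
`C₁ C₃ = C₂ C₄` lets the four local inequalities suffice.

Only one pattern is left: exactly one opposite pair is positive. An edge between the two then
carries two arcs whose centers differ by the rotation of its coupling, with radii such as `arctan
(|ν₁| / (4 √μ₁))`. By the addition theorem of the tangent, the inequality of the theorem says that
their interiors meet. If they do not, only finitely many configurations exist
(`mul_abs_cos_eq_of_disjoint_arcs`). -/

/-! ### A single orthodiagonal quadrilateral -/

/-- The numerator of `x + T / x`, up to the factor `2`, for `x = tan (θ / 2)`; the denominator is
`sin θ`. -/
noncomputable def involutionNum (T : ℝ) (θ : Real.Angle) : ℝ := ((1 + T) + (T - 1) * θ.cos) / 2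

theorem inner_vertexAlphaBeta_vertexBetaGamma (α γ δ : ℝ) (χ φ : Real.Angle) :
    inner ℝ (vertexAlphaBeta α δ χ) (vertexBetaGamma γ φ) =
      -φ.cos * sin γ * cos α * sin δ - sin α * χ.cos * cos δ * φ.cos * sin γ
        + sin α * sin γ * χ.sin * φ.sin + cos γ * cos α * cos δ - cos γ * sin α * χ.cos * sin δ := by
  simp [vertexAlphaBeta, vertexBetaGamma, PiLp.inner_apply, Fin.sum_univ_three]
  ring

theorem norm_vertexAlphaBeta (α δ : ℝ) (χ : Real.Angle) : ‖vertexAlphaBeta α δ χ‖ = 1 := by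
  have h := Real.Angle.cos_sq_add_sin_sq χ
  rw [EuclideanSpace.norm_eq, Real.sqrt_eq_one]
  simp [vertexAlphaBeta, Fin.sum_univ_three]
  linear_combination (sin α ^ 2) * h + (sin_sq_add_cos_sq α)
    + (cos α ^ 2 + sin α ^ 2 * χ.cos ^ 2) * (sin_sq_add_cos_sq δ)

theorem norm_vertexBetaGamma (γ : ℝ) (φ : Real.Angle) : ‖vertexBetaGamma γ φ‖ = 1 := by
  have h := Real.Angle.cos_sq_add_sin_sq φ
  rw [EuclideanSpace.norm_eq, Real.sqrt_eq_one]
  simp [vertexBetaGamma, Fin.sum_univ_three]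
  linear_combination (sin γ ^ 2) * h + (sin_sq_add_cos_sq γ)

theorem quadCloses_iff {α β γ δ : ℝ} (hβ : β ∈ Set.Ioo 0 π) (χ φ : Real.Angle) :
    QuadCloses α β γ δ χ φ ↔
      -φ.cos * sin γ * cos α * sin δ - sin α * χ.cos * cos δ * φ.cos * sin γ
        + sin α * sin γ * χ.sin * φ.sin + cos γ * cos α * cos δ - cos γ * sin α * χ.cos * sin δ
        = cos β := by
  rw [← inner_vertexAlphaBeta_vertexBetaGamma, QuadCloses]
  constructor
  · rintro rfl
    rw [InnerProductGeometry.cos_angle, norm_vertexAlphaBeta, norm_vertexBetaGamma]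
    simp
  · intro h
    rw [InnerProductGeometry.angle, norm_vertexAlphaBeta, norm_vertexBetaGamma, h]
    simp [arccos_cos hβ.1.le hβ.2.le]

theorem eq_of_cos_eq {a b : ℝ} (ha : a ∈ Set.Ioo 0 π) (hb : b ∈ Set.Ioo 0 π)
    (h : cos a = cos b) : a = b :=
  injOn_cos ⟨ha.1.le, ha.2.le⟩ ⟨hb.1.le, hb.2.le⟩ h

theorem eq_pi_sub_of_cos_eq_neg {a b : ℝ} (ha : a ∈ Set.Ioo 0 π) (hb : b ∈ Set.Ioo 0 π)
    (h : cos a = -cos b) : a = π - b := by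
  rw [← cos_pi_sub] at h
  exact eq_of_cos_eq ha ⟨by linarith [hb.2], by linarith [hb.1]⟩ h

theorem cos_ne_zero_of_ne {a : ℝ} (ha : a ∈ Set.Ioo 0 π) (h : a ≠ π / 2) : cos a ≠ 0 := by
  intro h0
  apply h
  apply eq_of_cos_eq ha ⟨by linarith [pi_pos], by linarith [pi_pos]⟩
  rw [h0, cos_pi_div_two]

theorem eq_of_sin_sub_eq_zero {a b : ℝ} (ha : a ∈ Set.Ioo 0 π) (hb : b ∈ Set.Ioo 0 π)
    (h : sin (a - b) = 0) : a = b := by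
  have := (sin_eq_zero_iff_of_lt_of_lt (by linarith [ha.1, hb.2]) (by linarith [ha.2, hb.1])).1 h
  linarith

theorem add_eq_pi_of_sin_add_eq_zero {a b : ℝ} (ha : a ∈ Set.Ioo 0 π) (hb : b ∈ Set.Ioo 0 π)
    (h : sin (a + b) = 0) : a + b = π := by
  have h' : sin (a + b - π) = 0 := by rw [sin_sub_pi, h, neg_zero]
  have := (sin_eq_zero_iff_of_lt_of_lt (by linarith [ha.1, hb.1]) (by linarith [ha.2, hb.2])).1 h'
  linarith

/-- In terms of half-angle tangents `x, y`, an elliptic orthodiagonal quadrilateral closes iff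
`(x + λ / x) (y + μ / y) = ν`. -/
theorem orthodiagonal_quadCloses_iff {α β γ δ : ℝ} (hα : α ∈ Set.Ioo 0 π) (hβ : β ∈ Set.Ioo 0 π)
    (hγ : γ ∈ Set.Ioo 0 π) (hδ : δ ∈ Set.Ioo 0 π) (ho : cos α * cos γ = cos β * cos δ)
    (h₁ : α - β + γ - δ ≠ 0) (h₂ : α + β - γ - δ ≠ 0) (h₃ : α + β + γ + δ ≠ 2 * π)
    (h₄ : α - β - γ + δ ≠ 0) :
    (involutionFactor α β γ δ ≠ 0 ∧ involutionFactor γ β α δ ≠ 0 ∧ nuFactor α β γ δ ≠ 0) ∧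
    ∀ χ φ, QuadCloses α β γ δ χ φ ↔
      4 * involutionNum (involutionFactor γ β α δ) φ * involutionNum (involutionFactor α β γ δ) χ
        = nuFactor α β γ δ * φ.sin * χ.sin := by
  have sα := sin_pos_of_mem_Ioo hα
  have sγ := sin_pos_of_mem_Ioo hγ
  have sδ := sin_pos_of_mem_Ioo hδ
  simp only [quadCloses_iff hβ]
  by_cases hδ2 : δ = π / 2
  · have cδ : cos δ = 0 := by rw [hδ2, cos_pi_div_two]
    have sδ1 : sin δ = 1 := by rw [hδ2, sin_pi_div_two]
    rw [cδ, mul_zero, mul_eq_zero] at ho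
    -- Since `cos δ = 0`, orthodiagonality forces `α` or `γ` to be right. `key` serves both cases,
    -- with `α` and `γ` exchanged in the second.
    have key : ∀ {α γ : ℝ}, α ∈ Set.Ioo 0 π → γ ∈ Set.Ioo 0 π →
        α - β + γ - δ ≠ 0 → α + β - γ - δ ≠ 0 → α + β + γ + δ ≠ 2 * π →
        α - β - γ + δ ≠ 0 → γ = π / 2 →
        cos β - cos α ≠ 0 ∧ involutionFactor α β γ δ = 1 ∧
        involutionFactor γ β α δ = (cos β + cos α) / (cos β - cos α) ∧
        involutionFactor γ β α δ ≠ 0 := by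
      intro α γ hα hγ h₁ h₂ h₃ h₄ hγ2
      have d1 : cos β - cos α ≠ 0 := fun h =>
        h₁ (by have := eq_of_cos_eq hβ hα (by linarith); rw [this, hγ2, hδ2]; ring)
      have d2 : cos β + cos α ≠ 0 := fun h =>
        h₃ (by have := eq_pi_sub_of_cos_eq_neg hβ hα (by linarith); rw [this, hγ2, hδ2]; ring)
      have e : involutionFactor γ β α δ = (cos β + cos α) / (cos β - cos α) := by
        simp [involutionFactor, hγ2, hδ2]
      refine ⟨d1, ?_, e, ?_⟩
      · rw [involutionFactor]
        by_cases hα2 : α = π / 2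
        · simp only [hα2, hγ2, hδ2, cos_pi_div_two, and_self, if_true] at d1 ⊢
          simpa using div_self d1
        · simp only [hα2, false_and, if_false]
          have := cos_ne_zero_of_ne hα hα2
          rw [sin_add, sin_sub, cδ, sδ1, div_eq_one_iff_eq (by simpa using this)]
          ring
      · rw [e]; exact div_ne_zero d2 d1
    by_cases hγ2 : γ = π / 2
    · obtain ⟨d1, e1, e2, n2⟩ := key hα hγ h₁ h₂ h₃ h₄ hγ2
      have cγ : cos γ = 0 := by rw [hγ2, cos_pi_div_two]
      have sγ1 : sin γ = 1 := by rw [hγ2, sin_pi_div_two]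
      have e3 : nuFactor α β γ δ = 4 * sin α / (cos β - cos α) := by
        simp [nuFactor, hδ2, hγ2]
      refine ⟨⟨by rw [e1]; exact one_ne_zero, n2, ?_⟩, ?_⟩
      · rw [e3]; exact div_ne_zero (by positivity) d1
      · intro χ φ
        rw [e1, e2, e3, cδ, cγ, sδ1, sγ1]
        simp only [involutionNum]
        field_simp
        constructor <;> intro h <;> linarith
    · have hα2 : α = π / 2 := by
        by_contra h
        rcases ho with h' | h'
        · exact cos_ne_zero_of_ne hα h h'
        · exact cos_ne_zero_of_ne hγ hγ2 h'
      obtain ⟨d1, e1, e2, n2⟩ := key hγ hα (by intro h; apply h₁; linarith)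
        (by intro h; apply h₄; linarith) (by intro h; apply h₃; linarith)
        (by intro h; apply h₂; linarith) hα2
      have cα : cos α = 0 := by rw [hα2, cos_pi_div_two]
      have sα1 : sin α = 1 := by rw [hα2, sin_pi_div_two]
      have e3 : nuFactor α β γ δ = 4 * sin γ / (cos β - cos γ) := by
        simp [nuFactor, hδ2, hγ2]
      refine ⟨⟨n2, by rw [e1]; exact one_ne_zero, ?_⟩, ?_⟩
      · rw [e3]; exact div_ne_zero (by positivity) d1
      · intro χ φ
        rw [e1, e2, e3, cδ, cα, sδ1, sα1]
        simp only [involutionNum]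
        field_simp
        constructor <;> intro h <;> linarith
  · have cδ := cos_ne_zero_of_ne hδ hδ2
    have key : ∀ {α γ : ℝ}, α ∈ Set.Ioo 0 π → γ ∈ Set.Ioo 0 π → cos α * cos γ = cos β * cos δ →
        α - β + γ - δ ≠ 0 → α + β + γ + δ ≠ 2 * π → sin (δ - α) ≠ 0 ∧ sin (δ + α) ≠ 0 := by
      intro α γ hα hγ ho h₁ h₃
      constructor
      · intro h
        have h := eq_of_sin_sub_eq_zero hδ hα h
        subst h
        have : cos γ = cos β := mul_left_cancel₀ cδ (by linarith)
        have := eq_of_cos_eq hγ hβ this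
        exact h₁ (by linarith)
      · intro h
        have h := add_eq_pi_of_sin_add_eq_zero hδ hα h
        have hα' : α = π - δ := by linarith
        subst hα'
        rw [cos_pi_sub] at ho
        have : cos γ = -cos β := mul_left_cancel₀ cδ (by linarith)
        have := eq_pi_sub_of_cos_eq_neg hγ hβ this
        exact h₃ (by linarith)
    obtain ⟨a1, a2⟩ := key hα hγ ho h₁ h₃
    obtain ⟨b1, b2⟩ := key hγ hα (by linarith) (by intro h; apply h₁; linarith)
      (by intro h; apply h₃; linarith)
    have e1 : involutionFactor α β γ δ = sin (δ + α) / sin (δ - α) := by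
      simp [involutionFactor, hδ2]
    have e2 : involutionFactor γ β α δ = sin (δ + γ) / sin (δ - γ) := by
      simp [involutionFactor, hδ2]
    have e3 : nuFactor α β γ δ = 4 * cos δ * sin α * sin γ / (sin (δ - α) * sin (δ - γ)) := by
      simp only [nuFactor, hδ2, if_false, e1, e2]
      field_simp
      rw [sin_add, sin_add, sin_sub, sin_sub]
      ring
    refine ⟨⟨by rw [e1]; exact div_ne_zero a2 a1, by rw [e2]; exact div_ne_zero b2 b1, ?_⟩, ?_⟩
    · rw [e3]
      exact div_ne_zero (mul_ne_zero (mul_ne_zero (mul_ne_zero (by norm_num) cδ) sα.ne') sγ.ne')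
        (mul_ne_zero a1 b1)
    · intro χ φ
      have n1 : involutionNum (sin (δ + α) / sin (δ - α)) χ
          = (sin δ * cos α + cos δ * sin α * χ.cos) / sin (δ - α) := by
        rw [involutionNum]
        field_simp
        rw [sin_add, sin_sub]; ring
      have n2 : involutionNum (sin (δ + γ) / sin (δ - γ)) φ
          = (sin δ * cos γ + cos δ * sin γ * φ.cos) / sin (δ - γ) := by
        rw [involutionNum]
        field_simp
        rw [sin_add, sin_sub]; ring
      rw [e1, e2, e3, n1, n2]
      -- Multiplied by `cos δ`, the closing condition contains `cos β cos δ = cos α cos γ`. It then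
      -- factors: the product of the numerators in `n1` and `n2` equals `cos δ sin α sin γ sin χ sin
      -- φ`.
      have h2 := sin_sq_add_cos_sq δ
      field_simp
      constructor <;> intro h
      · linear_combination (-cos δ) * h + ho + cos α * cos γ * h2
      · apply mul_left_cancel₀ cδ
        linear_combination (-1) * h + ho + cos α * cos γ * h2

/-! ### Couplings -/

/-- Homogeneous coordinates of `(x + T / x) / 2` for `x = tan (θ / 2)`. -/
noncomputable def involutionCoord (T : ℝ) (θ : Real.Angle) : ℝ × ℝ := (involutionNum T θ, θ.sin)

/-- Where the sine vanishes, the first coordinate is `T` or `1`, so the pair is a genuine point of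
the projective line. -/
theorem involutionCoord_ne_zero {T : ℝ} (hT : T ≠ 0) (θ : Real.Angle) :
    involutionCoord T θ ≠ 0 := by
  intro h
  have h1 : involutionNum T θ = 0 := congrArg Prod.fst h
  have h2 : θ.sin = 0 := congrArg Prod.snd h
  have h3 := Real.Angle.cos_sq_add_sin_sq θ
  rw [h2] at h3
  have h4 : (θ.cos - 1) * (θ.cos + 1) = 0 := by linear_combination h3
  rw [involutionNum] at h1
  rcases mul_eq_zero.1 h4 with h | h
  · apply hT; linear_combination h1 - (T - 1) / 2 * h
  · linarith [show θ.cos = -1 by linarith, h1, show (T - 1) * θ.cos = -(T - 1) by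
      rw [show θ.cos = -1 by linarith]; ring]

theorem InvolutiveCoupling.symm {F : OnePoint ℝ} {a b : ℝ} (h : InvolutiveCoupling F a b) :
    InvolutiveCoupling F b a := by
  refine ⟨fun hF => (h.1 hF).symm, fun h0 h1 => (h.2.1 h0 h1).symm, fun hF => ?_⟩
  rw [h.2.2 hF, one_div_one_div]

open Classical in
/-- An involutive coupling acts on the homogeneous coordinates as a rotation followed by a
scaling of the first coordinate. -/
theorem InvolutiveCoupling.rotation {F : OnePoint ℝ} {a b σ : ℝ} (h : InvolutiveCoupling F a b)
    (hF : F = if cos (σ / 2) = 0 then OnePoint.infty else ((tan (σ / 2) : ℝ) : OnePoint ℝ))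
    (hb : b ≠ 0) :
    couplingMultiplier F b ≠ 0 ∧ b = couplingMultiplier F b ^ 2 * a ∧
    (sin σ ≠ 0 → couplingMultiplier F b = 1 ∧ a = -1) ∧
    ∀ θ : Real.Angle,
      involutionNum b (θ + σ) =
        couplingMultiplier F b * (cos σ * involutionNum a θ + sin σ * θ.sin) ∧
      (θ + σ).sin = cos σ * θ.sin - sin σ * involutionNum a θ := by
  have hs : sin σ = 2 * sin (σ / 2) * cos (σ / 2) := by rw [← sin_two_mul]; congr 1; ring
  have hc : cos σ = 2 * cos (σ / 2) ^ 2 - 1 := by rw [← cos_two_mul]; congr 1; ring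
  have hsc := sin_sq_add_cos_sq (σ / 2)
  simp only [involutionNum, Real.Angle.cos_add, Real.Angle.sin_add, Real.Angle.cos_coe,
    Real.Angle.sin_coe]
  -- A half turn sends `x` to `-1 / x` and exchanges the thresholds `a` and `1 / a`. A trivial turn
  -- changes nothing. Any other turn comes with `a = b = -1`, where the coordinates are `(-cos θ,
  -- sin θ)` and simply rotate with `θ`.
  by_cases h0 : cos (σ / 2) = 0
  · rw [if_pos h0] at hF
    rw [h0, mul_zero] at hs
    rw [h0] at hc
    have ha : a = 1 / b := h.2.2 hF
    rw [couplingMultiplier, if_pos hF]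
    refine ⟨neg_ne_zero.2 hb, ?_, fun h => absurd hs h, fun θ => ?_⟩
    · rw [ha]; field_simp
    · rw [hs, hc, ha]
      constructor
      · field_simp; ring
      · ring
  · rw [if_neg h0] at hF
    have hFi : F ≠ OnePoint.infty := by rw [hF]; exact OnePoint.coe_ne_infty _
    rw [couplingMultiplier, if_neg hFi]
    by_cases h1 : sin (σ / 2) = 0
    · have ha : a = b := h.1 (by rw [hF, tan_eq_sin_div_cos, h1, zero_div])
      have hc1 : cos σ = 1 := by rw [hc]; rw [h1] at hsc; linarith
      rw [h1] at hs
      have hs0 : sin σ = 0 := by rw [hs]; ring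
      refine ⟨one_ne_zero, by rw [ha]; ring, fun h => absurd hs0 h, fun θ => ?_⟩
      rw [hs0, hc1, ha]
      constructor <;> ring
    · obtain ⟨ha, hb⟩ := h.2.1 (by
        rw [hF, Ne, OnePoint.coe_eq_coe, tan_eq_sin_div_cos]; exact div_ne_zero h1 h0) hFi
      refine ⟨one_ne_zero, by rw [ha, hb]; norm_num, fun _ => ⟨rfl, ha⟩, fun θ => ?_⟩
      rw [ha, hb]
      constructor <;> ring

namespace SkewKokotsakisMesh

variable (M : SkewKokotsakisMesh)

/-- The closing conditions of the four quadrilaterals, in homogeneous coordinates. -/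
def Relations (z₁ z₂ z₃ z₄ : ℝ × ℝ) : Prop :=
  4 * z₁.1 * z₂.1 = M.nu 1 * z₁.2 * z₂.2 ∧
  4 * (M.k2 * M.k3) * (M.tDen 2 * z₂.1 + M.tNum 2 * z₂.2) * (M.tDen 3 * z₃.1 + M.tNum 3 * z₃.2) =
    M.nu 2 * (M.tDen 2 * z₂.2 - M.tNum 2 * z₂.1) * (M.tDen 3 * z₃.2 - M.tNum 3 * z₃.1) ∧
  4 * z₃.1 * z₄.1 = M.nu 3 * z₃.2 * z₄.2 ∧
  4 * (M.k4 * M.k1) * (M.tDen 4 * z₄.1 + M.tNum 4 * z₄.2) * (M.tDen 1 * z₁.1 + M.tNum 1 * z₁.2) =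
    M.nu 4 * (M.tDen 4 * z₄.2 - M.tNum 4 * z₄.1) * (M.tDen 1 * z₁.2 - M.tNum 1 * z₁.1)

theorem tDen_sq_add_tNum_sq (i : ZMod 4) : M.tDen i ^ 2 + M.tNum i ^ 2 = 1 :=
  cos_sq_add_sin_sq _

variable {M}

theorem IsEllipticOI.quadCloses_iff (h : M.IsEllipticOI) (i : ZMod 4) :
    (M.lam i ≠ 0 ∧ M.mu i ≠ 0 ∧ M.nu i ≠ 0) ∧
    ∀ χ φ, QuadCloses (M.α i) (M.β i) (M.γ i) (M.δ i) χ φ ↔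
      4 * involutionNum (M.mu i) φ * involutionNum (M.lam i) χ = M.nu i * φ.sin * χ.sin := by
  have he := h.elliptic i
  refine orthodiagonal_quadCloses_iff (M.α_mem i) (M.β_mem i) (M.γ_mem i) (M.δ_mem i)
    (h.orthodiagonal i) ?_ ?_ ?_ ?_
  · intro h'
    refine he (-1) 1 (-1) (by simp) (by simp) (by simp) 0 ?_
    push_cast; linarith
  · intro h'
    refine he 1 (-1) (-1) (by simp) (by simp) (by simp) 0 ?_
    push_cast; linarith
  · intro h'
    refine he 1 1 1 (by simp) (by simp) (by simp) 1 ?_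
    push_cast; linarith
  · intro h'
    refine he (-1) (-1) 1 (by simp) (by simp) (by simp) 0 ?_
    push_cast; linarith

theorem IsEllipticOI.coupling_one (h : M.IsEllipticOI) :
    M.k1 ≠ 0 ∧ M.mu 4 = M.k1 ^ 2 * M.mu 1 ∧ (M.tNum 1 ≠ 0 → M.k1 = 1 ∧ M.mu 1 = -1) ∧
    ∀ θ : Real.Angle,
      involutionNum (M.mu 4) (θ + ((M.τ 1 + M.ζ 1 : ℝ) : Real.Angle)) =
        M.k1 * (M.tDen 1 * involutionNum (M.mu 1) θ + M.tNum 1 * θ.sin) ∧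
      (θ + ((M.τ 1 + M.ζ 1 : ℝ) : Real.Angle)).sin =
        M.tDen 1 * θ.sin - M.tNum 1 * involutionNum (M.mu 1) θ :=
  h.involutive.1.symm.rotation rfl (h.quadCloses_iff 4).1.2.1

theorem IsEllipticOI.coupling_two (h : M.IsEllipticOI) :
    M.k2 ≠ 0 ∧ M.lam 2 = M.k2 ^ 2 * M.lam 1 ∧ (M.tNum 2 ≠ 0 → M.k2 = 1 ∧ M.lam 1 = -1) ∧
    ∀ θ : Real.Angle,
      involutionNum (M.lam 2) (θ + ((M.τ 2 + M.ζ 2 : ℝ) : Real.Angle)) =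
        M.k2 * (M.tDen 2 * involutionNum (M.lam 1) θ + M.tNum 2 * θ.sin) ∧
      (θ + ((M.τ 2 + M.ζ 2 : ℝ) : Real.Angle)).sin =
        M.tDen 2 * θ.sin - M.tNum 2 * involutionNum (M.lam 1) θ :=
  h.involutive.2.1.rotation rfl (h.quadCloses_iff 2).1.1

theorem IsEllipticOI.coupling_three (h : M.IsEllipticOI) :
    M.k3 ≠ 0 ∧ M.mu 2 = M.k3 ^ 2 * M.mu 3 ∧ (M.tNum 3 ≠ 0 → M.k3 = 1 ∧ M.mu 3 = -1) ∧
    ∀ θ : Real.Angle,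
      involutionNum (M.mu 2) (θ + ((M.τ 3 + M.ζ 3 : ℝ) : Real.Angle)) =
        M.k3 * (M.tDen 3 * involutionNum (M.mu 3) θ + M.tNum 3 * θ.sin) ∧
      (θ + ((M.τ 3 + M.ζ 3 : ℝ) : Real.Angle)).sin =
        M.tDen 3 * θ.sin - M.tNum 3 * involutionNum (M.mu 3) θ :=
  h.involutive.2.2.1.symm.rotation rfl (h.quadCloses_iff 2).1.2.1

theorem IsEllipticOI.coupling_four (h : M.IsEllipticOI) :
    M.k4 ≠ 0 ∧ M.lam 4 = M.k4 ^ 2 * M.lam 3 ∧ (M.tNum 4 ≠ 0 → M.k4 = 1 ∧ M.lam 3 = -1) ∧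
    ∀ θ : Real.Angle,
      involutionNum (M.lam 4) (θ + ((M.τ 4 + M.ζ 4 : ℝ) : Real.Angle)) =
        M.k4 * (M.tDen 4 * involutionNum (M.lam 3) θ + M.tNum 4 * θ.sin) ∧
      (θ + ((M.τ 4 + M.ζ 4 : ℝ) : Real.Angle)).sin =
        M.tDen 4 * θ.sin - M.tNum 4 * involutionNum (M.lam 3) θ :=
  h.involutive.2.2.2.rotation rfl (h.quadCloses_iff 4).1.1

theorem IsEllipticOI.isConfiguration_iff (h : M.IsEllipticOI) (φ : ZMod 4 → Real.Angle) :
    M.IsConfiguration φ ↔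
      M.Relations (involutionCoord (M.mu 1) (φ 1)) (involutionCoord (M.lam 1) (φ 2))
        (involutionCoord (M.mu 3) (φ 3)) (involutionCoord (M.lam 3) (φ 4)) := by
  simp only [IsConfiguration, (h.quadCloses_iff _).2, psi, Relations, involutionCoord,
    h.coupling_one.2.2.2, h.coupling_two.2.2.2, h.coupling_three.2.2.2, h.coupling_four.2.2.2]
  refine and_congr Iff.rfl (and_congr ?_ (and_congr Iff.rfl ?_)) <;>
  constructor <;> intro h <;> linear_combination h

/-! ### Closing up around the cycle -/

/-- Needed to turn the vanishing minors into proportionality of the second row to the first. -/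
theorem IsEllipticOI.exists_row_ne_zero (h : M.IsEllipticOI) : ∃ j, M.N 0 j ≠ 0 := by
  by_contra! h0
  have h1 := h0 0
  have h2 := h0 1
  have h3 := h0 2
  have h4 := h0 3
  simp only [N, Matrix.of_apply, Matrix.cons_val] at h1 h2 h3 h4
  have hk2 := h.coupling_two.1
  have hk3 := h.coupling_three.1
  have hν := (h.quadCloses_iff 1).1.2.2
  have e2 := M.tDen_sq_add_tNum_sq 2
  have e3 := M.tDen_sq_add_tNum_sq 3
  -- The weights are adapted to the `k2 * k3` part of each entry: those parts add up to sums of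
  -- squares, while the `nu 2` parts cancel.
  have : M.k2 * M.k3 * M.nu 1 * (M.tDen 2 ^ 2 + M.tNum 2 ^ 2) * (M.tDen 3 ^ 2 + M.tNum 3 ^ 2) = 0 := by
    linear_combination (1 / 8) * M.tNum 2 * M.tDen 3 * M.nu 1 * h1
      + (1 / 16) * M.tNum 2 * M.tNum 3 * M.nu 1 * h2
      + (1 / 4) * M.tDen 2 * M.tDen 3 * h3 + (1 / 8) * M.tDen 2 * M.tNum 3 * h4
  rw [e2, e3, mul_one, mul_one] at this
  exact mul_ne_zero (mul_ne_zero hk2 hk3) hν this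

/-- After the second and fourth coordinates are eliminated through `Q₁` and `Q₃`, both conditions
are bilinear in `z₁, z₃`, with the rows of `N` as coefficients. The second row is a multiple of the
first. -/
theorem IsEllipticOI.relation_of_relation (h : M.IsEllipticOI) (z₁ z₃ : ℝ × ℝ)
    (h1 : 4 * (M.k2 * M.k3) * (M.tDen 2 * (M.nu 1 * z₁.2) + M.tNum 2 * (4 * z₁.1))
          * (M.tDen 3 * z₃.1 + M.tNum 3 * z₃.2) =
        M.nu 2 * (M.tDen 2 * (4 * z₁.1) - M.tNum 2 * (M.nu 1 * z₁.2))
          * (M.tDen 3 * z₃.2 - M.tNum 3 * z₃.1)) :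
    4 * (M.k4 * M.k1) * (M.tDen 4 * (M.nu 3 * z₃.2) + M.tNum 4 * (4 * z₃.1))
          * (M.tDen 1 * z₁.1 + M.tNum 1 * z₁.2) =
        M.nu 4 * (M.tDen 4 * (4 * z₃.1) - M.tNum 4 * (M.nu 3 * z₃.2))
          * (M.tDen 1 * z₁.2 - M.tNum 1 * z₁.1) := by
  have hp : ∀ i j, M.N 0 i * M.N 1 j = M.N 0 j * M.N 1 i := by
    intro i j
    rcases lt_trichotomy i j with hij | rfl | hij
    · have := h.minors i j hij
      rw [p] at this; linarith
    · rfl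
    · have := h.minors j i hij
      rw [p] at this; linarith
  -- The columns of `N` refer to `x + T / x`, which is twice the ratio of the coordinates; hence the
  -- factors `4, 2, 2, 1`.
  have e1 : M.N 0 0 * (4 * z₁.1 * z₃.1) + M.N 0 1 * (2 * z₁.1 * z₃.2)
      + M.N 0 2 * (2 * z₁.2 * z₃.1) + M.N 0 3 * (z₁.2 * z₃.2) = 0 := by
    simp only [N, Matrix.of_apply, Matrix.cons_val]
    linear_combination 2 * h1
  obtain ⟨j, hj⟩ := h.exists_row_ne_zero
  have e2 : M.N 0 j * (M.N 1 0 * (4 * z₁.1 * z₃.1) + M.N 1 1 * (2 * z₁.1 * z₃.2)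
      + M.N 1 2 * (2 * z₁.2 * z₃.1) + M.N 1 3 * (z₁.2 * z₃.2)) = 0 := by
    linear_combination M.N 1 j * e1 + (4 * z₁.1 * z₃.1) * hp j 0 + (2 * z₁.1 * z₃.2) * hp j 1
      + (2 * z₁.2 * z₃.1) * hp j 2 + (z₁.2 * z₃.2) * hp j 3
  have e3 := (mul_eq_zero.1 e2).resolve_left hj
  simp only [N, Matrix.of_apply, Matrix.cons_val] at e3
  linear_combination (1 / 2) * e3

/-! ### Solving the relations along the cycle from the second edge. -/

variable (M)

/-- The coordinates at the first edge, as a linear function of those at the second edge. -/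
noncomputable def firstCoord (z : ℝ × ℝ) : ℝ × ℝ := (M.nu 1 * z.2, 4 * z.1)

/-- The coordinates at the third edge, as a linear function of those at the second edge. -/
noncomputable def thirdCoord (z : ℝ × ℝ) : ℝ × ℝ :=
  (M.tDen 3 * (M.nu 2 * (M.tDen 2 * z.2 - M.tNum 2 * z.1))
      - M.tNum 3 * (4 * (M.k2 * M.k3) * (M.tDen 2 * z.1 + M.tNum 2 * z.2)),
    M.tDen 3 * (4 * (M.k2 * M.k3) * (M.tDen 2 * z.1 + M.tNum 2 * z.2))
      + M.tNum 3 * (M.nu 2 * (M.tDen 2 * z.2 - M.tNum 2 * z.1)))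

/-- The coordinates at the fourth edge, as a linear function of those at the second edge. -/
noncomputable def fourthCoord (z : ℝ × ℝ) : ℝ × ℝ :=
  (M.nu 3 * (M.thirdCoord z).2, 4 * (M.thirdCoord z).1)

variable {M}

theorem IsEllipticOI.relations (h : M.IsEllipticOI) (z : ℝ × ℝ) :
    M.Relations (M.firstCoord z) z (M.thirdCoord z) (M.fourthCoord z) := by
  have e3 := M.tDen_sq_add_tNum_sq 3
  refine ⟨?_, ?_, ?_, ?_⟩
  · simp only [firstCoord]; ring
  · simp only [thirdCoord]
    ring
  · simp only [fourthCoord]; ring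
  · have := h.relation_of_relation (M.firstCoord z) (M.thirdCoord z) (by
      simp only [firstCoord, thirdCoord]
      ring)
    simpa only [fourthCoord] using this

theorem IsEllipticOI.firstCoord_ne_zero (h : M.IsEllipticOI) {z : ℝ × ℝ} (hz : z ≠ 0) :
    M.firstCoord z ≠ 0 := by
  have hν := (h.quadCloses_iff 1).1.2.2
  intro h0
  simp only [firstCoord, Prod.mk_eq_zero, mul_eq_zero, hν, false_or] at h0
  exact hz (Prod.ext (h0.2.resolve_left (by norm_num)) h0.1)

theorem IsEllipticOI.thirdCoord_ne_zero (h : M.IsEllipticOI) {z : ℝ × ℝ} (hz : z ≠ 0) :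
    M.thirdCoord z ≠ 0 := by
  have hν := (h.quadCloses_iff 2).1.2.2
  have hk := mul_ne_zero h.coupling_two.1 h.coupling_three.1
  have e2 := M.tDen_sq_add_tNum_sq 2
  have e3 := M.tDen_sq_add_tNum_sq 3
  intro h0
  obtain ⟨h1, h2⟩ := Prod.mk_eq_zero.1 h0
  have h3 : M.nu 2 * (M.tDen 2 * z.2 - M.tNum 2 * z.1) = 0 := by
    linear_combination M.tDen 3 * h1 + M.tNum 3 * h2
      - M.nu 2 * (M.tDen 2 * z.2 - M.tNum 2 * z.1) * e3
  have h4 : (M.k2 * M.k3) * (4 * (M.tDen 2 * z.1 + M.tNum 2 * z.2)) = 0 := by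
    linear_combination M.tDen 3 * h2 - M.tNum 3 * h1
      - 4 * (M.k2 * M.k3) * (M.tDen 2 * z.1 + M.tNum 2 * z.2) * e3
  have h5 := (mul_eq_zero.1 h3).resolve_left hν
  have h6 := (mul_eq_zero.1 h4).resolve_left hk
  apply hz
  apply Prod.ext
  · show z.1 = 0
    linear_combination M.tDen 2 / 4 * h6 - M.tNum 2 * h5 - z.1 * e2
  · show z.2 = 0
    linear_combination M.tNum 2 / 4 * h6 + M.tDen 2 * h5 - z.2 * e2

theorem IsEllipticOI.fourthCoord_ne_zero (h : M.IsEllipticOI) {z : ℝ × ℝ} (hz : z ≠ 0) :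
    M.fourthCoord z ≠ 0 := by
  have hν := (h.quadCloses_iff 3).1.2.2
  intro h0
  simp only [fourthCoord, Prod.mk_eq_zero, mul_eq_zero, hν, false_or] at h0
  exact h.thirdCoord_ne_zero hz (Prod.ext (h0.2.resolve_left (by norm_num)) h0.1)

/-- The coordinate maps are invertible, so the projective point at any edge may be prescribed; only
the line spanned matters, hence the factor `r`. -/
theorem IsEllipticOI.exists_firstCoord_eq (h : M.IsEllipticOI) (z : ℝ × ℝ) :
    ∃ w, ∃ r : ℝ, r ≠ 0 ∧ M.firstCoord w = r • z := by
  refine ⟨(M.nu 1 * z.2, 4 * z.1), 4 * M.nu 1,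
    mul_ne_zero (by norm_num) (h.quadCloses_iff 1).1.2.2, ?_⟩
  ext <;> simp [firstCoord] <;> ring

theorem IsEllipticOI.exists_thirdCoord_eq (h : M.IsEllipticOI) (z : ℝ × ℝ) :
    ∃ w, ∃ r : ℝ, r ≠ 0 ∧ M.thirdCoord w = r • z := by
  have hν := (h.quadCloses_iff 2).1.2.2
  have hk := mul_ne_zero h.coupling_two.1 h.coupling_three.1
  have e2 := M.tDen_sq_add_tNum_sq 2
  have e3 := M.tDen_sq_add_tNum_sq 3
  set a := 4 * (M.k2 * M.k3) * (M.tDen 3 * z.1 + M.tNum 3 * z.2) with ha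
  set b := M.nu 2 * (M.tDen 3 * z.2 - M.tNum 3 * z.1) with hb
  refine ⟨(M.tDen 2 * b - M.tNum 2 * a, M.tDen 2 * a + M.tNum 2 * b),
    4 * (M.k2 * M.k3) * M.nu 2, mul_ne_zero (mul_ne_zero (by norm_num) hk) hν, ?_⟩
  have h1 : M.tDen 2 * (M.tDen 2 * a + M.tNum 2 * b) - M.tNum 2 * (M.tDen 2 * b - M.tNum 2 * a)
    = a := by linear_combination a * e2
  have h2 : M.tDen 2 * (M.tDen 2 * b - M.tNum 2 * a) + M.tNum 2 * (M.tDen 2 * a + M.tNum 2 * b)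
    = b := by linear_combination b * e2
  simp only [thirdCoord, h1, h2]
  apply Prod.ext
  · simp only [ha, hb, Prod.smul_fst, smul_eq_mul]
    linear_combination 4 * (M.k2 * M.k3) * M.nu 2 * z.1 * e3
  · simp only [ha, hb, Prod.smul_snd, smul_eq_mul]
    linear_combination 4 * (M.k2 * M.k3) * M.nu 2 * z.2 * e3

theorem IsEllipticOI.exists_fourthCoord_eq (h : M.IsEllipticOI) (z : ℝ × ℝ) :
    ∃ w, ∃ r : ℝ, r ≠ 0 ∧ M.fourthCoord w = r • z := by
  obtain ⟨w, r, hr, hw⟩ := h.exists_thirdCoord_eq (M.nu 3 * z.2, 4 * z.1)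
  refine ⟨w, r * (4 * M.nu 3),
    mul_ne_zero hr (mul_ne_zero (by norm_num) (h.quadCloses_iff 3).1.2.2), ?_⟩
  rw [fourthCoord, hw]
  ext <;> simp <;> ring

end SkewKokotsakisMesh

/-! ### Solutions of a single closing condition -/

theorem Real.Angle.finite_cos_preimage {s : Set ℝ} (hs : s.Finite) :
    (Real.Angle.cos ⁻¹' s).Finite := by
  refine hs.preimage' fun b _ => ?_
  rcases (Real.Angle.cos ⁻¹' {b}).eq_empty_or_nonempty with h | ⟨θ₀, h₀⟩
  · rw [h]; exact Set.finite_empty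
  · refine (Set.toFinite {θ₀, -θ₀}).subset fun θ hθ => ?_
    have : θ.cos = θ₀.cos := by
      rw [Set.mem_preimage, Set.mem_singleton_iff] at hθ h₀
      rw [hθ, h₀]
    simpa using Real.Angle.cos_eq_iff_eq_or_eq_neg.1 this

theorem finite_setOf_quadratic {p q r : ℝ} (h : p ≠ 0 ∨ q ≠ 0 ∨ r ≠ 0) :
    {c : ℝ | p * c ^ 2 + q * c + r = 0}.Finite := by
  set P : Polynomial ℝ := Polynomial.C p * Polynomial.X ^ 2 + Polynomial.C q * Polynomial.X
    + Polynomial.C r with hP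
  have hP0 : P ≠ 0 := by
    intro h0
    have e0 : P.coeff 0 = r := by simp [hP]
    have e1 : P.coeff 1 = q := by simp [hP, Polynomial.coeff_C]
    have e2 : P.coeff 2 = p := by simp [hP]
    rw [h0, Polynomial.coeff_zero] at e0 e1 e2
    rcases h with h | h | h
    · exact h e2.symm
    · exact h e1.symm
    · exact h e0.symm
  refine (P.rootSet_finite ℝ).subset fun c hc => ?_
  rw [Polynomial.mem_rootSet]
  refine ⟨hP0, ?_⟩
  simpa [hP] using hc

/-- Squaring and eliminating the sine leaves a quadratic equation for the cosine, whose coefficients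
cannot all vanish because `T ≠ 0`. -/
theorem finite_setOf_involutionNum {T A B : ℝ} (hT : T ≠ 0) (hAB : A ≠ 0 ∨ B ≠ 0) :
    {θ : Real.Angle | A * involutionNum T θ = B * θ.sin}.Finite := by
  have hfin : {c : ℝ | (A ^ 2 * (T - 1) ^ 2 + 4 * B ^ 2) * c ^ 2 + (2 * A ^ 2 * (T ^ 2 - 1)) * c
      + (A ^ 2 * (1 + T) ^ 2 - 4 * B ^ 2) = 0}.Finite := by
    apply finite_setOf_quadratic
    by_contra! h
    obtain ⟨h1, -, h3⟩ := h
    have hB : B = 0 := by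
      have : 0 ≤ A ^ 2 * (T - 1) ^ 2 := by positivity
      have : B ^ 2 = 0 := by nlinarith [sq_nonneg B]
      exact pow_eq_zero_iff (two_ne_zero) |>.1 this
    have hA : A ≠ 0 := hAB.resolve_right (not_not.2 hB)
    rw [hB] at h1 h3
    have : A ^ 2 * T = 0 := by linarith
    exact mul_ne_zero (pow_ne_zero 2 hA) hT this
  refine (Real.Angle.finite_cos_preimage hfin).subset fun θ hθ => ?_
  have h1 := Real.Angle.cos_sq_add_sin_sq θ
  simp only [Set.mem_ofPred_eq, involutionNum] at hθ
  simp only [Set.mem_preimage, Set.mem_ofPred_eq]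
  linear_combination 4 * (A * ((1 + T + (T - 1) * θ.cos) / 2) + B * θ.sin) * hθ + 4 * B ^ 2 * h1

/-- A real angle satisfies `|w| ≥ √T`, so the relation confines its partner `n / d` to a closed arc
around `0`. -/
theorem sqrt_mul_abs_le_of_relation {T ν n d : ℝ} {θ : Real.Angle} (hT : 0 < T)
    (h : 4 * involutionNum T θ * n = ν * θ.sin * d) : 4 * √T * |n| ≤ |ν| * |d| := by
  have h1 := Real.Angle.cos_sq_add_sin_sq θ
  have hN : 0 < involutionNum T θ := by
    rw [involutionNum]
    have h2 : -1 ≤ θ.cos := by nlinarith [sq_nonneg θ.sin]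
    have h3 : θ.cos ≤ 1 := by nlinarith [sq_nonneg θ.sin]
    rcases h2.eq_or_lt with h2 | h2
    · rw [← h2]; linarith
    · nlinarith
  have h2 : √T * |θ.sin| ≤ involutionNum T θ := by
    apply abs_le_of_sq_le_sq' _ hN.le |>.2
    rw [mul_pow, sq_sqrt hT.le, sq_abs, involutionNum]
    -- This square is exactly four times the difference of the two sides.
    nlinarith [sq_nonneg ((T - 1) + (T + 1) * θ.cos)]
  have h3 : 4 * involutionNum T θ * |n| = |ν| * |θ.sin| * |d| := by
    have := congrArg abs h
    rwa [abs_mul, abs_mul, abs_mul, abs_mul, abs_of_pos hN, abs_of_pos (by norm_num : (0:ℝ) < 4)]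
      at this
  have h4 : 0 ≤ |ν| * |d| := by positivity
  have h5 := mul_le_mul_of_nonneg_right h2 h4
  refine le_of_mul_le_mul_left ?_ hN
  linear_combination h5 + √T * h3

/-- A half-angle solution of `x + T / x = 2 w`. -/
noncomputable def liftAngle (T w : ℝ) : Real.Angle :=
  ((2 * arctan (w + √(w ^ 2 - T)) : ℝ) : Real.Angle)

theorem continuous_liftAngle (T : ℝ) : Continuous (liftAngle T) :=
  Real.Angle.continuous_coe.comp (by fun_prop)

theorem exists_involutionCoord_liftAngle {T : ℝ} {z : ℝ × ℝ} (hT : T ≠ 0) (hz : z.2 ≠ 0)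
    (h : T * z.2 ^ 2 < z.1 ^ 2) :
    ∃ r : ℝ, r ≠ 0 ∧ involutionCoord T (liftAngle T (z.1 / z.2)) = r • z := by
  obtain ⟨w, hw⟩ : ∃ w, w = z.1 / z.2 := ⟨_, rfl⟩
  rw [← hw]
  have hwz : z.1 = w * z.2 := by rw [hw]; field_simp
  have hwT : 0 ≤ w ^ 2 - T := by
    rw [hwz, mul_pow] at h
    have : 0 < z.2 ^ 2 := by positivity
    nlinarith
  obtain ⟨x, hx⟩ : ∃ x, x = w + √(w ^ 2 - T) := ⟨_, rfl⟩
  have hxe : x ^ 2 + T = 2 * x * w := by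
    have := sq_sqrt hwT
    rw [hx]; linear_combination this
  have hpos : 0 < 1 + x ^ 2 := by positivity
  have hc2 := cos_sq_arctan x
  have hcos : (liftAngle T w).cos = (1 - x ^ 2) / (1 + x ^ 2) := by
    rw [liftAngle, Real.Angle.cos_coe, cos_two_mul, ← hx, hc2]
    field_simp; ring
  have hsin : (liftAngle T w).sin = 2 * x / (1 + x ^ 2) := by
    have hc := cos_arctan_pos x
    have ht := tan_mul_cos hc.ne'
    rw [tan_arctan] at ht
    rw [liftAngle, Real.Angle.sin_coe, sin_two_mul, ← hx, ← ht]
    rw [show 2 * (x * cos (arctan x)) * cos (arctan x) = 2 * x * cos (arctan x) ^ 2 by ring, hc2]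
    ring
  have hN : involutionNum T (liftAngle T w) = 2 * x / (1 + x ^ 2) * w := by
    rw [involutionNum, hcos]
    field_simp
    linear_combination 2 * hxe
  have key : involutionCoord T (liftAngle T w) = (2 * x / (1 + x ^ 2) / z.2) • z := by
    apply Prod.ext
    · simp only [involutionCoord, hN, Prod.smul_fst, smul_eq_mul, hwz]; field_simp
    · simp only [involutionCoord, hsin, Prod.smul_snd, smul_eq_mul]; field_simp
  refine ⟨_, ?_, key⟩
  intro h0
  rw [h0, zero_smul] at key
  exact involutionCoord_ne_zero hT _ key

namespace SkewKokotsakisMesh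

variable {M : SkewKokotsakisMesh}

/-! ### Criterion for rigidity -/

theorem IsEllipticOI.finite_setOf_quadCloses_right (h : M.IsEllipticOI) (i : ZMod 4)
    (χ : Real.Angle) : {φ | QuadCloses (M.α i) (M.β i) (M.γ i) (M.δ i) χ φ}.Finite := by
  obtain ⟨⟨hl, hm, hn⟩, hq⟩ := h.quadCloses_iff i
  simp only [hq]
  have hχ : 4 * involutionNum (M.lam i) χ ≠ 0 ∨ M.nu i * χ.sin ≠ 0 := by
    by_contra! h0
    apply involutionCoord_ne_zero hl χ
    exact Prod.mk_eq_zero.2 ⟨by simpa using h0.1, by simpa [hn] using h0.2⟩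
  refine (finite_setOf_involutionNum hm hχ).subset fun φ hφ => ?_
  simp only [Set.mem_ofPred_eq] at hφ ⊢
  linear_combination hφ

theorem IsEllipticOI.finite_setOf_quadCloses_left (h : M.IsEllipticOI) (i : ZMod 4)
    (φ : Real.Angle) : {χ | QuadCloses (M.α i) (M.β i) (M.γ i) (M.δ i) χ φ}.Finite := by
  obtain ⟨⟨hl, hm, hn⟩, hq⟩ := h.quadCloses_iff i
  simp only [hq]
  have hφ : 4 * involutionNum (M.mu i) φ ≠ 0 ∨ M.nu i * φ.sin ≠ 0 := by
    by_contra! h0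
    apply involutionCoord_ne_zero hm φ
    exact Prod.mk_eq_zero.2 ⟨by simpa using h0.1, by simpa [hn] using h0.2⟩
  exact finite_setOf_involutionNum hl hφ

theorem not_isFlexible_of_finite {S : Set Real.Angle} (hS : S.Finite)
    (h : ∀ φ, M.IsConfiguration φ → ∀ i, φ i ∈ S) : ¬ M.IsFlexible := by
  rintro ⟨φ, -, hinj, hφ⟩
  have hfin : (Set.pi Set.univ fun _ : ZMod 4 => S).Finite := Set.Finite.pi fun _ => hS
  have : Infinite unitInterval := (Set.Icc_infinite zero_lt_one).to_subtype
  refine Set.infinite_range_of_injective hinj (hfin.subset ?_)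
  rintro _ ⟨u, rfl⟩ i -
  exact h _ (hφ u) i

theorem forall_zmod_four {p : ZMod 4 → Prop} (h1 : p 1) (h2 : p 2) (h3 : p 3) (h4 : p 4) :
    ∀ i, p i := by
  intro i
  fin_cases i
  exacts [h4, h1, h2, h3]

/-- In a closing quadrilateral one angle leaves finitely many values for the other. Finiteness thus
spreads from edge 2 to edges 1 and 3, and from 3 to 4. -/
theorem IsEllipticOI.not_isFlexible_of_finite_two (hM : M.IsEllipticOI) {S : Set Real.Angle}
    (hS : S.Finite) (h : ∀ φ, M.IsConfiguration φ → φ 2 ∈ S) : ¬ M.IsFlexible := by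
  have hS1 := hS.biUnion fun χ _ => hM.finite_setOf_quadCloses_right 1 χ
  have hS3 := hS.biUnion fun χ _ => ((hM.finite_setOf_quadCloses_right 2
    (χ + ((M.τ 2 + M.ζ 2 : ℝ) : Real.Angle))).image
      fun θ => θ - ((M.τ 3 + M.ζ 3 : ℝ) : Real.Angle))
  have hS4 := hS3.biUnion fun φ _ => hM.finite_setOf_quadCloses_left 3 φ
  refine not_isFlexible_of_finite (((hS.union hS1).union hS3).union hS4) fun φ hφ => ?_
  have h2 := h φ hφ
  obtain ⟨q1, q2, q3, -⟩ := hφ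
  have h1 := Set.mem_biUnion (t := fun χ => {φ | QuadCloses (M.α 1) (M.β 1) (M.γ 1) (M.δ 1) χ φ})
    h2 q1
  have h3 : φ 3 ∈ ⋃ χ ∈ S, (fun θ => θ - ((M.τ 3 + M.ζ 3 : ℝ) : Real.Angle)) ''
      {φ | QuadCloses (M.α 2) (M.β 2) (M.γ 2) (M.δ 2)
        (χ + ((M.τ 2 + M.ζ 2 : ℝ) : Real.Angle)) φ} :=
    Set.mem_biUnion h2 ⟨_, q2, add_sub_cancel_right _ _⟩
  have h4 := Set.mem_biUnion (t := fun φ => {χ | QuadCloses (M.α 3) (M.β 3) (M.γ 3) (M.δ 3) χ φ})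
    h3 q3
  exact forall_zmod_four (Or.inl (Or.inl (Or.inr h1))) (Or.inl (Or.inl (Or.inl h2)))
    (Or.inl (Or.inr h3)) (Or.inr h4)

theorem IsEllipticOI.not_isFlexible_of_finite_three (hM : M.IsEllipticOI) {S : Set Real.Angle}
    (hS : S.Finite) (h : ∀ φ, M.IsConfiguration φ → φ 3 ∈ S) : ¬ M.IsFlexible := by
  have hS2 := hS.biUnion fun φ _ => ((hM.finite_setOf_quadCloses_left 2
    (φ + ((M.τ 3 + M.ζ 3 : ℝ) : Real.Angle))).image
      fun θ => θ - ((M.τ 2 + M.ζ 2 : ℝ) : Real.Angle))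
  refine hM.not_isFlexible_of_finite_two hS2 fun φ hφ => ?_
  exact Set.mem_biUnion (h φ hφ) ⟨_, hφ.2.1, add_sub_cancel_right _ _⟩

/-! ### Disjoint arcs force rigidity. -/

/-- Two closed arcs of the projective line whose interiors are disjoint meet only in boundary
points. -/
theorem mul_abs_cos_eq_of_disjoint_arcs {p q a b : ℝ} {θ σ : Real.Angle} (hp : 0 < p) (hq : 0 < q)
    (ha : 0 < a) (hb : 0 < b) (hσ : σ.sin ≠ 0)
    (h : (p * b + q * a) * |σ.cos| ≤ (p * q - a * b) * |σ.sin|)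
    (h1 : p * |θ.cos| ≤ a * |θ.sin|) (h2 : q * |(θ + σ).cos| ≤ b * |(θ + σ).sin|) :
    p * |θ.cos| = a * |θ.sin| := by
  have hpq : 0 ≤ p * q - a * b := by
    have : 0 < |σ.sin| := abs_pos.2 hσ
    by_contra! h0
    have : 0 ≤ (p * b + q * a) * |σ.cos| := by positivity
    nlinarith
  obtain ⟨ψ, hψ⟩ : ∃ ψ, ψ = θ + σ := ⟨_, rfl⟩
  rw [← hψ] at h2
  have hσψ : σ = ψ + -θ := by rw [hψ]; abel
  have eθ := Real.Angle.cos_sq_add_sin_sq θ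
  have eψ := Real.Angle.cos_sq_add_sin_sq ψ
  have e1 : |σ.sin| ≤ |ψ.sin| * |θ.cos| + |ψ.cos| * |θ.sin| := by
    rw [hσψ, Real.Angle.sin_add, Real.Angle.cos_neg, Real.Angle.sin_neg,
      mul_neg, ← abs_mul, ← abs_mul, ← sub_eq_add_neg]
    exact abs_sub _ _
  have e2 : |ψ.sin| * |θ.sin| - |ψ.cos| * |θ.cos| ≤ |σ.cos| := by
    rw [hσψ, Real.Angle.cos_add, Real.Angle.cos_neg, Real.Angle.sin_neg,
      mul_neg, sub_neg_eq_add, ← abs_mul, ← abs_mul, add_comm (ψ.cos * θ.cos)]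
    have := abs_sub_abs_le_abs_sub (ψ.sin * θ.sin) (-(ψ.cos * θ.cos))
    rwa [abs_neg, sub_neg_eq_add] at this
  have e3 : 0 < q * |ψ.sin| + b * |ψ.cos| := by
    by_contra! h0
    have f1 : |ψ.sin| = 0 := by nlinarith [abs_nonneg ψ.sin, abs_nonneg ψ.cos]
    have f2 : |ψ.cos| = 0 := by nlinarith [abs_nonneg ψ.sin, abs_nonneg ψ.cos]
    rw [abs_eq_zero] at f1 f2
    rw [f1, f2] at eψ
    norm_num at eψ
  have e4 : 0 ≤ p * |θ.sin| + a * |θ.cos| := by positivity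
  have e5 : (p * b + q * a) * (|ψ.sin| * |θ.sin| - |ψ.cos| * |θ.cos|) ≤
      (p * q - a * b) * (|ψ.sin| * |θ.cos| + |ψ.cos| * |θ.sin|) :=
    (mul_le_mul_of_nonneg_left e2 (by positivity)).trans
      (h.trans (mul_le_mul_of_nonneg_left e1 hpq))
  -- Expanded, `e5` says that the product in `e7` is at least the one in `e6`.
  have e6 : 0 ≤ (p * |θ.sin| + a * |θ.cos|) * (b * |ψ.sin| - q * |ψ.cos|) :=
    mul_nonneg e4 (by linarith)
  have e7 : 0 ≤ (p * |θ.cos| - a * |θ.sin|) * (q * |ψ.sin| + b * |ψ.cos|) := by linarith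
  have e8 := nonneg_of_mul_nonneg_left e7 e3
  linarith

theorem involutionNum_neg_one (θ : Real.Angle) : involutionNum (-1) θ = -θ.cos := by
  rw [involutionNum]; ring

theorem finite_setOf_mul_abs_cos_eq {p a : ℝ} (hp : p ≠ 0) :
    {θ : Real.Angle | p * |θ.cos| = a * |θ.sin|}.Finite := by
  have h1 := finite_setOf_involutionNum (T := -1) (A := p) (B := a) (by norm_num) (Or.inl hp)
  have h2 := finite_setOf_involutionNum (T := -1) (A := p) (B := -a) (by norm_num) (Or.inl hp)
  refine (h1.union h2).subset fun θ hθ => ?_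
  simp only [Set.mem_union, Set.mem_ofPred_eq, involutionNum_neg_one] at hθ ⊢
  rcases abs_choice θ.cos with hc | hc <;> rcases abs_choice θ.sin with hs | hs <;>
    rw [hc, hs] at hθ
  · right; linarith
  · left; linarith
  · left; linarith
  · right; linarith

/-- `Q₁` and `Q₂` alone are the obstruction: `Q₁` confines `φ 2` to an arc and `Q₂` confines `ψ 2`.
A genuine rotation forces `lam 1 = lam 2 = -1`, so the arcs can be compared through the angles
themselves. -/
theorem IsEllipticOI.not_isFlexible_of_mu_pos (h : M.IsEllipticOI) (h1 : 0 < M.mu 1)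
    (h2 : 0 < M.mu 2) (ht : M.tNum 2 ≠ 0)
    (hle : (4 * |M.nu 2| * √(M.mu 1) + 4 * |M.nu 1| * √(M.mu 2)) / |M.tNum 2| * |M.tDen 2| ≤
      16 * √(M.mu 1 * M.mu 2) - |M.nu 1 * M.nu 2|) : ¬ M.IsFlexible := by
  have hp : 0 < 4 * √(M.mu 1) := by have := sqrt_pos.2 h1; positivity
  have hq : 0 < 4 * √(M.mu 2) := by have := sqrt_pos.2 h2; positivity
  have hk := h.coupling_two
  obtain ⟨hk1, hl1⟩ := hk.2.2.1 ht
  have hl2 : M.lam 2 = -1 := by rw [hk.2.1, hk1, hl1]; norm_num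
  refine h.not_isFlexible_of_finite_two
    (finite_setOf_mul_abs_cos_eq (p := 4 * √(M.mu 1)) (a := |M.nu 1|) hp.ne') fun φ hφ => ?_
  obtain ⟨q1, q2, -, -⟩ := hφ
  rw [(h.quadCloses_iff 1).2, hl1, involutionNum_neg_one] at q1
  rw [(h.quadCloses_iff 2).2, hl2, involutionNum_neg_one] at q2
  have r1 := sqrt_mul_abs_le_of_relation h1 q1
  have r2 := sqrt_mul_abs_le_of_relation h2 q2
  rw [abs_neg] at r1 r2
  refine mul_abs_cos_eq_of_disjoint_arcs (σ := ((M.τ 2 + M.ζ 2 : ℝ) : Real.Angle)) hp hq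
    (abs_pos.2 (h.quadCloses_iff 1).1.2.2) (abs_pos.2 (h.quadCloses_iff 2).1.2.2)
    (by rw [Real.Angle.sin_coe]; exact ht) ?_ r1 r2
  rw [Real.Angle.sin_coe, Real.Angle.cos_coe]
  change _ * |M.tDen 2| ≤ _ * |M.tNum 2|
  rw [sqrt_mul h1.le, abs_mul, div_mul_eq_mul_div, div_le_iff₀ (abs_pos.2 ht)] at hle
  linarith

theorem IsEllipticOI.not_isFlexible_of_lam_pos (h : M.IsEllipticOI) (h2 : 0 < M.lam 2)
    (h3 : 0 < M.lam 3) (ht : M.tNum 3 ≠ 0)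
    (hle : (4 * |M.nu 3| * √(M.lam 2) + 4 * |M.nu 2| * √(M.lam 3)) / |M.tNum 3| * |M.tDen 3| ≤
      16 * √(M.lam 2 * M.lam 3) - |M.nu 2 * M.nu 3|) : ¬ M.IsFlexible := by
  have hp : 0 < 4 * √(M.lam 3) := by have := sqrt_pos.2 h3; positivity
  have hq : 0 < 4 * √(M.lam 2) := by have := sqrt_pos.2 h2; positivity
  have hk := h.coupling_three
  obtain ⟨hk1, hm3⟩ := hk.2.2.1 ht
  have hm2 : M.mu 2 = -1 := by rw [hk.2.1, hk1, hm3]; norm_num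
  refine h.not_isFlexible_of_finite_three
    (finite_setOf_mul_abs_cos_eq (p := 4 * √(M.lam 3)) (a := |M.nu 3|) hp.ne') fun φ hφ => ?_
  obtain ⟨-, q2, q3, -⟩ := hφ
  rw [(h.quadCloses_iff 3).2, hm3, involutionNum_neg_one] at q3
  rw [(h.quadCloses_iff 2).2, hm2, involutionNum_neg_one] at q2
  have r1 := sqrt_mul_abs_le_of_relation (ν := M.nu 3) (θ := φ 4) (n := -(φ 3).cos) (d := (φ 3).sin) h3
    (by linear_combination q3)
  have r2 := sqrt_mul_abs_le_of_relation (ν := M.nu 2) (θ := M.psi φ 2)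
    (n := -(M.psi φ 3).cos) (d := (M.psi φ 3).sin) h2 (by linear_combination q2)
  rw [abs_neg] at r1 r2
  refine mul_abs_cos_eq_of_disjoint_arcs (σ := ((M.τ 3 + M.ζ 3 : ℝ) : Real.Angle)) hp hq
    (abs_pos.2 (h.quadCloses_iff 3).1.2.2) (abs_pos.2 (h.quadCloses_iff 2).1.2.2)
    (by rw [Real.Angle.sin_coe]; exact ht) ?_ r1 r2
  rw [Real.Angle.sin_coe, Real.Angle.cos_coe]
  change _ * |M.tDen 3| ≤ _ * |M.tNum 3|
  rw [sqrt_mul h2.le, abs_mul, div_mul_eq_mul_div, div_le_iff₀ (abs_pos.2 ht)] at hle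
  linarith

/-! ### Criterion for flexibility -/

theorem Relations.smul {z₁ z₂ z₃ z₄ : ℝ × ℝ} (h : M.Relations z₁ z₂ z₃ z₄) (r₁ r₂ r₃ r₄ : ℝ) :
    M.Relations (r₁ • z₁) (r₂ • z₂) (r₃ • z₃) (r₄ • z₄) := by
  obtain ⟨h1, h2, h3, h4⟩ := h
  simp only [Relations, Prod.smul_fst, Prod.smul_snd, smul_eq_mul]
  refine ⟨?_, ?_, ?_, ?_⟩
  · linear_combination r₁ * r₂ * h1
  · linear_combination r₂ * r₃ * h2
  · linear_combination r₃ * r₄ * h3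
  · linear_combination r₄ * r₁ * h4

/-! ### Moving a point of the projective line and lifting it to real angles. -/

/-- The lines through the origin near the one spanned by `z`. -/
def pencil (z : ℝ × ℝ) (s : ℝ) : ℝ × ℝ := (z.1 - s * z.2, z.2 + s * z.1)

theorem normSq_pos {z : ℝ × ℝ} (hz : z ≠ 0) : 0 < z.1 ^ 2 + z.2 ^ 2 := by
  by_contra! h
  exact hz (Prod.ext (by simpa using (by nlinarith [sq_nonneg z.1, sq_nonneg z.2] : z.1 ^ 2 = 0))
    (by simpa using (by nlinarith [sq_nonneg z.1, sq_nonneg z.2] : z.2 ^ 2 = 0)))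

/-- The lift divides by the second coordinate, so its zeros must be avoidable. A linear form is
affine in `s` along the pencil; two zeros would make it vanish at `z` and at its quarter turn, hence
identically. -/
theorem finite_setOf_pencil {f : ℝ × ℝ → ℝ × ℝ} {P Q : ℝ} (hf : ∀ z, (f z).2 = P * z.1 + Q * z.2)
    (hf0 : ∃ w, (f w).2 ≠ 0) {z : ℝ × ℝ} (hz : z ≠ 0) :
    {s | (f (pencil z s)).2 = 0}.Finite := by
  apply Set.Subsingleton.finite
  intro s hs t ht
  simp only [Set.mem_ofPred_eq, hf, pencil] at hs ht
  by_contra hst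
  have hst' : s - t ≠ 0 := sub_ne_zero.2 hst
  have h1 : (s - t) * (Q * z.1 - P * z.2) = 0 := by linear_combination hs - ht
  have h2 := (mul_eq_zero.1 h1).resolve_left hst'
  have h3 : P * z.1 + Q * z.2 = 0 := by linear_combination hs - s * h2
  have hn := (normSq_pos hz).ne'
  have hP : P = 0 := by
    have : P * (z.1 ^ 2 + z.2 ^ 2) = 0 := by linear_combination z.1 * h3 - z.2 * h2
    exact (mul_eq_zero.1 this).resolve_right hn
  have hQ : Q = 0 := by
    have : Q * (z.1 ^ 2 + z.2 ^ 2) = 0 := by linear_combination z.2 * h3 + z.1 * h2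
    exact (mul_eq_zero.1 this).resolve_right hn
  obtain ⟨w, hw⟩ := hf0
  exact hw (by rw [hf, hP, hQ]; ring)

theorem exists_segment {ι : Type*} [Finite ι] {T : ι → ℝ} {f : ι → ℝ → ℝ × ℝ}
    (hf : ∀ i, Continuous (f i)) (h0 : ∀ i, T i * (f i 0).2 ^ 2 < (f i 0).1 ^ 2)
    (hfin : ∀ i, {s | (f i s).2 = 0}.Finite) :
    ∃ s : unitInterval → ℝ, Continuous s ∧ Function.Injective s ∧
      ∀ u i, T i * (f i (s u)).2 ^ 2 < (f i (s u)).1 ^ 2 ∧ (f i (s u)).2 ≠ 0 := by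
  have hO : IsOpen (⋂ i, {s | T i * (f i s).2 ^ 2 < (f i s).1 ^ 2}) :=
    isOpen_iInter_of_finite fun i => isOpen_lt
      (by have := hf i; fun_prop) (by have := hf i; fun_prop)
  have hB : (⋃ i, {s | (f i s).2 = 0}).Finite := Set.finite_iUnion hfin
  obtain ⟨s₀, hs₀⟩ := (hB.countable.dense_compl ℝ).inter_open_nonempty _ hO
    ⟨0, Set.mem_iInter.2 h0⟩
  obtain ⟨ε, hε, hball⟩ := Metric.isOpen_iff.1 (hO.inter hB.isClosed.isOpen_compl) s₀ hs₀
  refine ⟨fun u => s₀ + ε / 2 * (u : ℝ), by fun_prop, fun u v huv => ?_, fun u i => ?_⟩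
  · have : ε / 2 * ((u : ℝ) - v) = 0 := by linear_combination huv
    exact Subtype.ext (sub_eq_zero.1 ((mul_eq_zero.1 this).resolve_left (by positivity)))
  · have hu := hball (show s₀ + ε / 2 * (u : ℝ) ∈ Metric.ball s₀ ε by
      have := u.2.1
      have := u.2.2
      rw [Metric.mem_ball, Real.dist_eq, add_sub_cancel_left, abs_of_nonneg (by positivity)]
      nlinarith)
    refine ⟨Set.mem_iInter.1 hu.1 i, fun h => hu.2 (Set.mem_iUnion.2 ⟨i, h⟩)⟩

/-- The strict inequalities persist on a short segment of the pencil, where one fixed root of `x + T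
/ x = 2 w` lifts all four coordinates continuously. The lift is injective because the line at the
second edge determines the parameter. -/
theorem IsEllipticOI.isFlexible_of_point (h : M.IsEllipticOI) {z : ℝ × ℝ} (hz : z ≠ 0)
    (h1 : M.mu 1 * (M.firstCoord z).2 ^ 2 < (M.firstCoord z).1 ^ 2)
    (h2 : M.lam 1 * z.2 ^ 2 < z.1 ^ 2)
    (h3 : M.mu 3 * (M.thirdCoord z).2 ^ 2 < (M.thirdCoord z).1 ^ 2)
    (h4 : M.lam 3 * (M.fourthCoord z).2 ^ 2 < (M.fourthCoord z).1 ^ 2) : M.IsFlexible := by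
  have c2 : Continuous (pencil z) := by unfold pencil; fun_prop
  have c1 : Continuous M.firstCoord := by unfold firstCoord; fun_prop
  have c3 : Continuous M.thirdCoord := by unfold thirdCoord; fun_prop
  have c4 : Continuous M.fourthCoord := by unfold fourthCoord; fun_prop
  have f1 : {s | (M.firstCoord (pencil z s)).2 = 0}.Finite := by
    refine finite_setOf_pencil (P := 4) (Q := 0) (fun z => by simp [firstCoord])
      ⟨(1, 0), by simp [firstCoord]⟩ hz
  have f2 : {s | (pencil z s).2 = 0}.Finite :=
    finite_setOf_pencil (f := id) (P := 0) (Q := 1) (fun z => by simp) ⟨(0, 1), by simp⟩ hz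
  have f3 : {s | (M.thirdCoord (pencil z s)).2 = 0}.Finite := by
    obtain ⟨w, r, hr, hw⟩ := h.exists_thirdCoord_eq (0, 1)
    refine finite_setOf_pencil
      (P := 4 * M.tDen 3 * (M.k2 * M.k3) * M.tDen 2 - M.tNum 3 * M.nu 2 * M.tNum 2)
      (Q := 4 * M.tDen 3 * (M.k2 * M.k3) * M.tNum 2 + M.tNum 3 * M.nu 2 * M.tDen 2)
      (fun z => by simp only [thirdCoord]; ring) ⟨w, by rw [hw]; simpa using hr⟩ hz
  have f4 : {s | (M.fourthCoord (pencil z s)).2 = 0}.Finite := by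
    obtain ⟨w, r, hr, hw⟩ := h.exists_fourthCoord_eq (0, 1)
    refine finite_setOf_pencil
      (P := -4 * (M.tDen 3 * M.nu 2 * M.tNum 2 + 4 * M.tNum 3 * (M.k2 * M.k3) * M.tDen 2))
      (Q := 4 * (M.tDen 3 * M.nu 2 * M.tDen 2 - 4 * M.tNum 3 * (M.k2 * M.k3) * M.tNum 2))
      (fun z => by simp only [fourthCoord, thirdCoord]; ring) ⟨w, by rw [hw]; simpa using hr⟩ hz
  have hp0 : pencil z 0 = z := by simp [pencil]
  obtain ⟨T, hT⟩ : ∃ T : ZMod 4 → ℝ, T 1 = M.mu 1 ∧ T 2 = M.lam 1 ∧ T 3 = M.mu 3 ∧ T 4 = M.lam 3 :=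
    ⟨![M.lam 3, M.mu 1, M.lam 1, M.mu 3], rfl, rfl, rfl, rfl⟩
  obtain ⟨f, hf⟩ : ∃ f : ZMod 4 → ℝ → ℝ × ℝ, f 1 = (fun s => M.firstCoord (pencil z s)) ∧
      f 2 = pencil z ∧ f 3 = (fun s => M.thirdCoord (pencil z s)) ∧
      f 4 = (fun s => M.fourthCoord (pencil z s)) :=
    ⟨![_, _, _, _], rfl, rfl, rfl, rfl⟩
  obtain ⟨T1, T2, T3, T4⟩ := hT
  obtain ⟨e1, e2, e3, e4⟩ := hf
  have hT0 : ∀ i, T i ≠ 0 := forall_zmod_four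
    (by rw [T1]; exact (h.quadCloses_iff 1).1.2.1) (by rw [T2]; exact (h.quadCloses_iff 1).1.1)
    (by rw [T3]; exact (h.quadCloses_iff 3).1.2.1) (by rw [T4]; exact (h.quadCloses_iff 3).1.1)
  have hfc : ∀ i, Continuous (f i) := forall_zmod_four
    (by rw [e1]; exact c1.comp c2) (by rw [e2]; exact c2)
    (by rw [e3]; exact c3.comp c2) (by rw [e4]; exact c4.comp c2)
  obtain ⟨s, hsc, hsi, hs⟩ := exists_segment (T := T) (f := f) hfc
    (forall_zmod_four (by simpa only [e1, T1, hp0] using h1) (by simpa only [e2, T2, hp0] using h2)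
      (by simpa only [e3, T3, hp0] using h3) (by simpa only [e4, T4, hp0] using h4))
    (forall_zmod_four (by rwa [e1]) (by rwa [e2]) (by rwa [e3]) (by rwa [e4]))
  have hlift := fun u i => exists_involutionCoord_liftAngle (hT0 i) (hs u i).2 (hs u i).1
  refine ⟨fun u i => liftAngle (T i) ((f i (s u)).1 / (f i (s u)).2),
    continuous_pi fun i => (continuous_liftAngle (T i)).comp
      ((((hfc i).comp hsc).fst).div (((hfc i).comp hsc).snd) fun u => (hs u i).2), ?_, fun u => ?_⟩
  · intro u v huv
    have huv2 : liftAngle (T 2) ((f 2 (s u)).1 / (f 2 (s u)).2) =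
      liftAngle (T 2) ((f 2 (s v)).1 / (f 2 (s v)).2) := congrFun huv 2
    obtain ⟨r, hr, hu⟩ := hlift u 2
    obtain ⟨r', hr', hv⟩ := hlift v 2
    rw [huv2, hv, e2] at hu
    have g1 : r' * (z.1 - s v * z.2) = r * (z.1 - s u * z.2) := congrArg Prod.fst hu
    have g2 : r' * (z.2 + s v * z.1) = r * (z.2 + s u * z.1) := congrArg Prod.snd hu
    have g3 : r * (s u - s v) * (z.1 ^ 2 + z.2 ^ 2) = 0 := by
      linear_combination (s v * z.1 + z.2) * g1 - (z.1 - s v * z.2) * g2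
    rcases mul_eq_zero.1 g3 with g | g
    · exact hsi (sub_eq_zero.1 ((mul_eq_zero.1 g).resolve_left hr))
    · exact absurd g (normSq_pos hz).ne'
  · obtain ⟨r1, -, a1⟩ := hlift u 1
    obtain ⟨r2, -, a2⟩ := hlift u 2
    obtain ⟨r3, -, a3⟩ := hlift u 3
    obtain ⟨r4, -, a4⟩ := hlift u 4
    rw [h.isConfiguration_iff, ← T1, ← T2, ← T3, ← T4, a1, a2, a3, a4, e1, e2, e3, e4]
    exact (h.relations (pencil z (s u))).smul r1 r2 r3 r4

end SkewKokotsakisMesh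

/-! ### Choosing points of the projective line -/

theorem mul_sq_lt_sq_of_neg {T : ℝ} {z : ℝ × ℝ} (hT : T < 0) (hz : z ≠ 0) :
    T * z.2 ^ 2 < z.1 ^ 2 := by
  have := SkewKokotsakisMesh.normSq_pos hz
  rcases (sq_nonneg z.2).eq_or_lt with h | h
  · rw [← h] at this ⊢; linarith
  · nlinarith [sq_nonneg z.1]

/-- Strict converse of `sqrt_mul_abs_le_of_relation`: a partner inside the open arc puts `n / d`
above its threshold. -/
theorem mul_sq_lt_sq_of_relation {T ν n d x y : ℝ} (hT : 0 < T) (hz : (n, d) ≠ 0)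
    (h : 4 * n * x = ν * d * y) (hlt : 4 * √T * |x| < |ν| * |y|) : T * d ^ 2 < n ^ 2 := by
  by_cases hd : d = 0
  · have hn : n ≠ 0 := fun hn => hz (by rw [hn, hd]; rfl)
    rw [hd]
    have : 0 < n ^ 2 := by positivity
    linarith
  have h1 : 0 < |ν| * |y| := lt_of_le_of_lt (by positivity) hlt
  have hνy : ν * y ≠ 0 := by rw [← abs_pos, abs_mul]; exact h1
  have hx : x ≠ 0 := by
    rintro rfl
    have : d * (ν * y) = 0 := by linear_combination -h
    exact (mul_ne_zero hd hνy) this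
  have h2 : (4 * √T * |x|) ^ 2 < (|ν| * |y|) ^ 2 := pow_lt_pow_left₀ hlt (by positivity) two_ne_zero
  rw [mul_pow, mul_pow, mul_pow, sq_sqrt hT.le, sq_abs, sq_abs, sq_abs] at h2
  have h3 : 16 * n ^ 2 * x ^ 2 = ν ^ 2 * d ^ 2 * y ^ 2 := by
    linear_combination (4 * n * x + ν * d * y) * h
  have hd2 : 0 < d ^ 2 := by positivity
  have h4 := mul_lt_mul_of_pos_left h2 hd2
  have hx2 : 0 < 16 * x ^ 2 := by positivity
  refine lt_of_mul_lt_mul_left ?_ hx2.le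
  linarith

/-- Two open arcs of the projective line overlap if the distance of their centers is less than the
sum of their radii. -/
theorem exists_mem_arcs {p q a b c s : ℝ} (hp : 0 < p) (hq : 0 < q) (ha : 0 < a) (hb : 0 < b)
    (hs : s ≠ 0) (h : (p * q - a * b) * |s| < (p * b + q * a) * |c|) :
    ∃ z : ℝ × ℝ, z ≠ 0 ∧ p * |z.1| < a * |z.2| ∧
      q * |c * z.1 + s * z.2| < b * |c * z.2 - s * z.1| := by
  have hs' : 0 < |s| := abs_pos.2 hs
  have hc' := abs_nonneg c
  -- The point `(±x, 1)`, with sign opposite to that of `c * s`, moves from the center `(0, 1)` of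
  -- the first arc towards the center of the second, where `z.1 / z.2 = -s / c`. If that center lies
  -- in the first arc it is taken; otherwise `x` is chosen between the near end of the second arc
  -- and the end `a / p` of the first.
  obtain ⟨x, hx0, hxa, hx⟩ : ∃ x, 0 ≤ x ∧ p * x < a ∧
      q * |(|s| - |c| * x)| < b * (|c| + |s| * x) := by
    rcases lt_or_ge (p * |s|) (a * |c|) with h1 | h1
    · have hc : 0 < |c| := by
        by_contra! h0
        have : 0 < p * |s| := by positivity
        nlinarith
      refine ⟨|s| / |c|, by positivity, ?_, ?_⟩
      · rw [← mul_div_assoc, div_lt_iff₀ hc]; exact h1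
      · rw [mul_div_cancel₀ _ hc.ne', sub_self, abs_zero, mul_zero]
        positivity
    · have h2 : 0 < q * |c| + b * |s| := by positivity
      obtain ⟨x, hx1, hx2⟩ := exists_between
        (show max 0 ((q * |s| - b * |c|) / (q * |c| + b * |s|)) < a / p by
          apply max_lt (by positivity)
          rw [div_lt_div_iff₀ h2 hp]
          linarith)
      obtain ⟨hx0, hx1⟩ := max_lt_iff.1 hx1
      rw [lt_div_iff₀ hp] at hx2
      rw [div_lt_iff₀ h2] at hx1
      refine ⟨x, hx0.le, by linarith, ?_⟩
      have h3 : 0 ≤ |s| - |c| * x := by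
        have : p * (|c| * x) ≤ p * |s| := by nlinarith
        linarith [le_of_mul_le_mul_left this hp]
      rw [abs_of_nonneg h3]
      linarith
  rcases le_total 0 c with hc | hc <;> rcases le_total 0 s with hs | hs
  · rw [abs_of_nonneg hc, abs_of_nonneg hs] at hx
    refine ⟨(-x, 1), fun h => one_ne_zero (congrArg Prod.snd h), ?_, ?_⟩
    · simpa [abs_of_nonneg hx0] using hxa
    · have e : c * 1 - s * -x = c + s * x := by ring
      have e' : c * -x + s * 1 = s - c * x := by ring
      simp only [e, e']
      rwa [abs_of_nonneg (by positivity : 0 ≤ c + s * x)]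
  · rw [abs_of_nonneg hc, abs_of_nonpos hs] at hx
    refine ⟨(x, 1), fun h => one_ne_zero (congrArg Prod.snd h), ?_, ?_⟩
    · simpa [abs_of_nonneg hx0] using hxa
    · have e : c * 1 - s * x = c + -s * x := by ring
      have e' : c * x + s * 1 = -(-s - c * x) := by ring
      simp only [e, e']
      rw [abs_neg, abs_of_nonneg (add_nonneg hc (mul_nonneg (neg_nonneg.2 hs) hx0))]
      exact hx
  · rw [abs_of_nonpos hc, abs_of_nonneg hs] at hx
    refine ⟨(x, 1), fun h => one_ne_zero (congrArg Prod.snd h), ?_, ?_⟩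
    · simpa [abs_of_nonneg hx0] using hxa
    · have e : c * 1 - s * x = -(-c + s * x) := by ring
      have e' : c * x + s * 1 = s - -c * x := by ring
      simp only [e, e']
      rw [abs_neg, abs_of_nonneg (add_nonneg (neg_nonneg.2 hc) (mul_nonneg hs hx0))]
      exact hx
  · rw [abs_of_nonpos hc, abs_of_nonpos hs] at hx
    refine ⟨(-x, 1), fun h => one_ne_zero (congrArg Prod.snd h), ?_, ?_⟩
    · simpa [abs_of_nonneg hx0] using hxa
    · have e : c * 1 - s * -x = -(-c + -s * x) := by ring
      have e' : c * -x + s * 1 = -(-s - -c * x) := by ring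
      simp only [e, e']
      rw [abs_neg, abs_neg,
        abs_of_nonneg (add_nonneg (neg_nonneg.2 hc) (mul_nonneg (neg_nonneg.2 hs) hx0))]
      exact hx

theorem mul_sq_lt_sq_of_mul_eq {T C y : ℝ} {z w : ℝ × ℝ} (hy : 0 < y) (hzy : z.1 ^ 2 = y)
    (hz2 : z.2 = 1) (hw : w ≠ 0) (h : z.1 * w.1 = C * z.2 * w.2) (hC : T * y < C ^ 2) :
    T * w.2 ^ 2 < w.1 ^ 2 := by
  rw [hz2, mul_one] at h
  have h1 : y * w.1 ^ 2 = C ^ 2 * w.2 ^ 2 := by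
    rw [← hzy]; linear_combination (z.1 * w.1 + C * w.2) * h
  have hw2 : w.2 ≠ 0 := by
    intro h0
    rw [h0] at h1
    have : w.1 ^ 2 = 0 := by
      have : y * w.1 ^ 2 = 0 := by linarith
      exact (mul_eq_zero.1 this).resolve_left hy.ne'
    exact hw (Prod.ext (by simpa using this) h0)
  have h2 : 0 < w.2 ^ 2 := by positivity
  refine lt_of_mul_lt_mul_left ?_ hy.le
  rw [h1]
  nlinarith

/-- A point slightly above the threshold `T` forces its neighbors above their thresholds. -/
theorem exists_mul_sq_lt_sq {T T₁ T₂ C₁ C₂ : ℝ} (hT : 0 < T) (h₁ : T₁ ≠ 0) (h₂ : T₂ ≠ 0)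
    (hC₁ : 0 < T₁ → T * T₁ < C₁ ^ 2) (hC₂ : 0 < T₂ → T * T₂ < C₂ ^ 2) :
    ∃ z : ℝ × ℝ, z ≠ 0 ∧ T * z.2 ^ 2 < z.1 ^ 2 ∧
      (∀ w : ℝ × ℝ, w ≠ 0 → (0 < T₁ → z.1 * w.1 = C₁ * z.2 * w.2) → T₁ * w.2 ^ 2 < w.1 ^ 2) ∧
      (∀ w : ℝ × ℝ, w ≠ 0 → (0 < T₂ → z.1 * w.1 = C₂ * z.2 * w.2) → T₂ * w.2 ^ 2 < w.1 ^ 2) := by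
  -- For `z = (√y, 1)` a neighbor asks for `y < C ^ 2 / T'`, and only if its threshold is positive.
  have aux : ∀ {T' C : ℝ}, (0 < T' → T * T' < C ^ 2) → ∃ U, T < U ∧ ∀ y < U, 0 < T' → T' * y < C ^ 2 := by
    intro T' C h
    by_cases hT' : 0 < T'
    · refine ⟨C ^ 2 / T', (lt_div_iff₀ hT').2 (h hT'), fun y hy _ => ?_⟩
      rw [lt_div_iff₀ hT'] at hy
      linarith
    · exact ⟨T + 1, by linarith, fun _ _ h => absurd h hT'⟩
  obtain ⟨U₁, hU₁, hU₁'⟩ := aux hC₁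
  obtain ⟨U₂, hU₂, hU₂'⟩ := aux hC₂
  obtain ⟨y, hTy, hyU⟩ := exists_between (lt_min hU₁ hU₂)
  obtain ⟨hy₁, hy₂⟩ := lt_min_iff.1 hyU
  have hy : 0 < y := hT.trans hTy
  have hsq := sq_sqrt hy.le
  refine ⟨(√y, 1), fun h => one_ne_zero (congrArg Prod.snd h), ?_, ?_, ?_⟩
  · simpa [hsq] using hTy
  · intro w hw h
    rcases h₁.lt_or_gt with h' | h'
    · exact mul_sq_lt_sq_of_neg h' hw
    · exact mul_sq_lt_sq_of_mul_eq hy hsq rfl hw (h h') (hU₁' y hy₁ h')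
  · intro w hw h
    rcases h₂.lt_or_gt with h' | h'
    · exact mul_sq_lt_sq_of_neg h' hw
    · exact mul_sq_lt_sq_of_mul_eq hy hsq rfl hw (h h') (hU₂' y hy₂ h')

theorem smul_mul_sq_lt_sq {T r : ℝ} {z : ℝ × ℝ} (hr : r ≠ 0) (h : T * z.2 ^ 2 < z.1 ^ 2) :
    T * (r • z).2 ^ 2 < (r • z).1 ^ 2 := by
  have : 0 < r ^ 2 := by positivity
  simp only [Prod.smul_fst, Prod.smul_snd, smul_eq_mul]
  nlinarith

/-! ### Prescribing the coordinate at an arbitrary edge. -/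

namespace SkewKokotsakisMesh

variable {M : SkewKokotsakisMesh}

/-- The coordinates at the four edges belong to a flexible mesh if all of them lie strictly above
their thresholds. -/
def FlexesAt (M : SkewKokotsakisMesh) (z₁ z₂ z₃ z₄ : ℝ × ℝ) : Prop :=
  M.mu 1 * z₁.2 ^ 2 < z₁.1 ^ 2 → M.lam 1 * z₂.2 ^ 2 < z₂.1 ^ 2 →
  M.mu 3 * z₃.2 ^ 2 < z₃.1 ^ 2 → M.lam 3 * z₄.2 ^ 2 < z₄.1 ^ 2 → M.IsFlexible

theorem IsEllipticOI.exists_relations_second (h : M.IsEllipticOI) {z : ℝ × ℝ} (hz : z ≠ 0) :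
    ∃ z₁ z₃ z₄, z₁ ≠ 0 ∧ z₃ ≠ 0 ∧ z₄ ≠ 0 ∧ M.Relations z₁ z z₃ z₄ ∧ M.FlexesAt z₁ z z₃ z₄ :=
  ⟨_, _, _, h.firstCoord_ne_zero hz, h.thirdCoord_ne_zero hz, h.fourthCoord_ne_zero hz,
    h.relations z, h.isFlexible_of_point hz⟩

theorem ne_zero_of_map_eq_smul {f : ℝ × ℝ → ℝ × ℝ} (hf : f 0 = 0) {w z : ℝ × ℝ} {r : ℝ}
    (hr : r ≠ 0) (hz : z ≠ 0) (hw : f w = r • z) : w ≠ 0 := by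
  rintro rfl
  exact smul_ne_zero hr hz (hw.symm.trans hf)

theorem IsEllipticOI.exists_relations_first (h : M.IsEllipticOI) {z : ℝ × ℝ} (hz : z ≠ 0) :
    ∃ z₂ z₃ z₄, z₂ ≠ 0 ∧ z₃ ≠ 0 ∧ z₄ ≠ 0 ∧ M.Relations z z₂ z₃ z₄ ∧ M.FlexesAt z z₂ z₃ z₄ := by
  obtain ⟨w, r, hr, hw⟩ := h.exists_firstCoord_eq z
  have hw0 := ne_zero_of_map_eq_smul (by simp [firstCoord]) hr hz hw
  refine ⟨w, _, _, hw0, h.thirdCoord_ne_zero hw0, h.fourthCoord_ne_zero hw0, ?_, fun h1 =>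
    h.isFlexible_of_point hw0 (by rw [hw]; exact smul_mul_sq_lt_sq hr h1)⟩
  have := (h.relations w).smul r⁻¹ 1 1 1
  simpa only [hw, inv_smul_smul₀ hr, one_smul] using this

theorem IsEllipticOI.exists_relations_third (h : M.IsEllipticOI) {z : ℝ × ℝ} (hz : z ≠ 0) :
    ∃ z₁ z₂ z₄, z₁ ≠ 0 ∧ z₂ ≠ 0 ∧ z₄ ≠ 0 ∧ M.Relations z₁ z₂ z z₄ ∧ M.FlexesAt z₁ z₂ z z₄ := by
  obtain ⟨w, r, hr, hw⟩ := h.exists_thirdCoord_eq z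
  have hw0 := ne_zero_of_map_eq_smul (by simp [thirdCoord]) hr hz hw
  refine ⟨_, w, _, h.firstCoord_ne_zero hw0, hw0, h.fourthCoord_ne_zero hw0, ?_,
    fun h1 h2 h3 => h.isFlexible_of_point hw0 h1 h2 (by rw [hw]; exact smul_mul_sq_lt_sq hr h3)⟩
  have := (h.relations w).smul 1 1 r⁻¹ 1
  simpa only [hw, inv_smul_smul₀ hr, one_smul] using this

theorem IsEllipticOI.exists_relations_fourth (h : M.IsEllipticOI) {z : ℝ × ℝ} (hz : z ≠ 0) :
    ∃ z₁ z₂ z₃, z₁ ≠ 0 ∧ z₂ ≠ 0 ∧ z₃ ≠ 0 ∧ M.Relations z₁ z₂ z₃ z ∧ M.FlexesAt z₁ z₂ z₃ z := by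
  obtain ⟨w, r, hr, hw⟩ := h.exists_fourthCoord_eq z
  have hw0 := ne_zero_of_map_eq_smul (by simp [fourthCoord, thirdCoord]) hr hz hw
  refine ⟨_, w, _, h.firstCoord_ne_zero hw0, hw0, h.thirdCoord_ne_zero hw0, ?_,
    fun h1 h2 h3 h4 => h.isFlexible_of_point hw0 h1 h2 h3
      (by rw [hw]; exact smul_mul_sq_lt_sq hr h4)⟩
  have := (h.relations w).smul 1 1 1 r⁻¹
  simpa only [hw, inv_smul_smul₀ hr, one_smul] using this

/-! ### Adjacent edges -/

/-- A coupling with a genuine rotation has threshold `-1`, so positive thresholds exclude it. -/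
theorem tNum_eq_zero_of_pos {i : ZMod 4} {k T : ℝ} (h : M.tNum i ≠ 0 → k = 1 ∧ T = -1)
    (hT : 0 < T) : M.tNum i = 0 := by
  by_contra h0
  linarith [(h h0).2]

theorem tDen_ne_zero_of_tNum_eq_zero {i : ZMod 4} (h : M.tNum i = 0) : M.tDen i ≠ 0 := by
  intro h0
  have := M.tDen_sq_add_tNum_sq i
  rw [h, h0] at this
  norm_num at this

theorem LocalExistence.mul_lt (h : M.LocalExistence) {i : ZMod 4} (hl : 0 < M.lam i)
    (hm : 0 < M.mu i) : 16 * (M.lam i * M.mu i) < M.nu i ^ 2 := by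
  rcases h i with h | ⟨-, -, h⟩
  · rcases h with h | h <;> linarith
  · rwa [lt_div_iff₀ (mul_pos hl hm)] at h

theorem Relations.mul_eq_one_two {z₁ z₂ z₃ z₄ : ℝ × ℝ} (h : M.Relations z₁ z₂ z₃ z₄) :
    z₁.1 * z₂.1 = M.nu 1 / 4 * z₁.2 * z₂.2 := by
  linear_combination (1 / 4) * h.1

theorem Relations.mul_eq_three_four {z₁ z₂ z₃ z₄ : ℝ × ℝ} (h : M.Relations z₁ z₂ z₃ z₄) :
    z₃.1 * z₄.1 = M.nu 3 / 4 * z₃.2 * z₄.2 := by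
  linear_combination (1 / 4) * h.2.2.1

theorem Relations.mul_eq_two_three {z₁ z₂ z₃ z₄ : ℝ × ℝ} (h : M.Relations z₁ z₂ z₃ z₄)
    (hM : M.IsEllipticOI) (h2 : 0 < M.lam 1) (h3 : 0 < M.mu 3) :
    z₂.1 * z₃.1 = M.nu 2 / (4 * (M.k2 * M.k3)) * z₂.2 * z₃.2 := by
  have hk := mul_ne_zero hM.coupling_two.1 hM.coupling_three.1
  have s2 := tNum_eq_zero_of_pos hM.coupling_two.2.2.1 h2
  have s3 := tNum_eq_zero_of_pos hM.coupling_three.2.2.1 h3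
  have c2 := tDen_ne_zero_of_tNum_eq_zero s2
  have c3 := tDen_ne_zero_of_tNum_eq_zero s3
  have h' := h.2.1
  rw [s2, s3] at h'
  apply mul_left_cancel₀ (mul_ne_zero hk (mul_ne_zero c2 c3))
  rw [← mul_right_inj' (by norm_num : (4 : ℝ) ≠ 0)]
  have hk4 : 4 * (M.k2 * M.k3) ≠ 0 := mul_ne_zero (by norm_num) hk
  have e : 4 * (M.k2 * M.k3) * (M.nu 2 / (4 * (M.k2 * M.k3))) = M.nu 2 := mul_div_cancel₀ _ hk4
  linear_combination h' - M.tDen 2 * M.tDen 3 * z₂.2 * z₃.2 * e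

theorem Relations.mul_eq_four_one {z₁ z₂ z₃ z₄ : ℝ × ℝ} (h : M.Relations z₁ z₂ z₃ z₄)
    (hM : M.IsEllipticOI) (h4 : 0 < M.lam 3) (h1 : 0 < M.mu 1) :
    z₄.1 * z₁.1 = M.nu 4 / (4 * (M.k4 * M.k1)) * z₄.2 * z₁.2 := by
  have hk := mul_ne_zero hM.coupling_four.1 hM.coupling_one.1
  have s4 := tNum_eq_zero_of_pos hM.coupling_four.2.2.1 h4
  have s1 := tNum_eq_zero_of_pos hM.coupling_one.2.2.1 h1
  have c4 := tDen_ne_zero_of_tNum_eq_zero s4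
  have c1 := tDen_ne_zero_of_tNum_eq_zero s1
  have h' := h.2.2.2
  rw [s4, s1] at h'
  apply mul_left_cancel₀ (mul_ne_zero hk (mul_ne_zero c4 c1))
  rw [← mul_right_inj' (by norm_num : (4 : ℝ) ≠ 0)]
  have hk4 : 4 * (M.k4 * M.k1) ≠ 0 := mul_ne_zero (by norm_num) hk
  have e : 4 * (M.k4 * M.k1) * (M.nu 4 / (4 * (M.k4 * M.k1))) = M.nu 4 := mul_div_cancel₀ _ hk4
  linear_combination h' - M.tDen 4 * M.tDen 1 * z₄.2 * z₁.2 * e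

/-- Transports local existence of `Q₂` and `Q₄` across the couplings to the thresholds of `Q₁` and
`Q₃`. -/
theorem mul_lt_div_sq {a b c d k k' ν : ℝ} (hk : k ≠ 0) (hk' : k' ≠ 0) (hc : c = k ^ 2 * a)
    (hd : d = k' ^ 2 * b) (h : 16 * (c * d) < ν ^ 2) : a * b < (ν / (4 * (k * k'))) ^ 2 := by
  rw [div_pow, lt_div_iff₀ (by positivity)]
  rw [hc, hd] at h
  linarith

theorem LocalExistence.lt_one_two (hloc : M.LocalExistence) (h1 : 0 < M.mu 1)
    (h2 : 0 < M.lam 1) : M.mu 1 * M.lam 1 < (M.nu 1 / 4) ^ 2 := by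
  linarith [hloc.mul_lt h2 h1]

theorem LocalExistence.lt_three_four (hloc : M.LocalExistence) (h3 : 0 < M.mu 3)
    (h4 : 0 < M.lam 3) : M.mu 3 * M.lam 3 < (M.nu 3 / 4) ^ 2 := by
  linarith [hloc.mul_lt h4 h3]

theorem IsEllipticOI.lt_two_three (h : M.IsEllipticOI) (hloc : M.LocalExistence)
    (h2 : 0 < M.lam 1) (h3 : 0 < M.mu 3) :
    M.lam 1 * M.mu 3 < (M.nu 2 / (4 * (M.k2 * M.k3))) ^ 2 := by
  obtain ⟨k2, e2, -⟩ := h.coupling_two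
  obtain ⟨k3, e3, -⟩ := h.coupling_three
  exact mul_lt_div_sq k2 k3 e2 e3 (hloc.mul_lt (by rw [e2]; positivity) (by rw [e3]; positivity))

theorem IsEllipticOI.lt_four_one (h : M.IsEllipticOI) (hloc : M.LocalExistence)
    (h4 : 0 < M.lam 3) (h1 : 0 < M.mu 1) :
    M.lam 3 * M.mu 1 < (M.nu 4 / (4 * (M.k4 * M.k1))) ^ 2 := by
  obtain ⟨k4, e4, -⟩ := h.coupling_four
  obtain ⟨k1, e1, -⟩ := h.coupling_one
  exact mul_lt_div_sq k4 k1 e4 e1 (hloc.mul_lt (by rw [e4]; positivity) (by rw [e1]; positivity))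

/-! ### Flexibility for the different sign patterns -/

/-- The point `(1, 0)`, that is `w = ∞`, lies above every threshold, so the sign of `lam 1` does not
matter. -/
theorem IsEllipticOI.isFlexible_of_neg (h : M.IsEllipticOI) (h1 : M.mu 1 < 0) (h3 : M.mu 3 < 0)
    (h4 : M.lam 3 < 0) : M.IsFlexible := by
  obtain ⟨z₁, z₃, z₄, n1, n3, n4, -, hf⟩ := h.exists_relations_second
    (z := (1, 0)) (fun h => one_ne_zero (congrArg Prod.fst h))
  exact hf (mul_sq_lt_sq_of_neg h1 n1) (by norm_num) (mul_sq_lt_sq_of_neg h3 n3)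
    (mul_sq_lt_sq_of_neg h4 n4)

/-- Slightly above the threshold of edge 1, local existence takes care of edges 2 and 4, and the
opposite edge imposes nothing. The same argument works from each of the other edges. -/
theorem IsEllipticOI.isFlexible_of_first_pos (h : M.IsEllipticOI) (hloc : M.LocalExistence)
    (h1 : 0 < M.mu 1) (h3 : M.mu 3 < 0) : M.IsFlexible := by
  obtain ⟨z, hz, hza, f2, f4⟩ := exists_mul_sq_lt_sq h1 (h.quadCloses_iff 1).1.1
    (h.quadCloses_iff 3).1.1 (fun h2 => hloc.lt_one_two h1 h2)
    (fun h4 => by rw [mul_comm]; exact h.lt_four_one hloc h4 h1)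
  obtain ⟨z₂, z₃, z₄, n2, n3, n4, hr, hf⟩ := h.exists_relations_first hz
  exact hf hza (f2 z₂ n2 fun _ => hr.mul_eq_one_two) (mul_sq_lt_sq_of_neg h3 n3)
    (f4 z₄ n4 fun h4 => by linear_combination hr.mul_eq_four_one h h4 h1)

theorem IsEllipticOI.isFlexible_of_second_pos (h : M.IsEllipticOI) (hloc : M.LocalExistence)
    (h2 : 0 < M.lam 1) (h4 : M.lam 3 < 0) : M.IsFlexible := by
  obtain ⟨z, hz, hza, f1, f3⟩ := exists_mul_sq_lt_sq h2 (h.quadCloses_iff 1).1.2.1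
    (h.quadCloses_iff 3).1.2.1
    (fun h1 => by rw [mul_comm]; exact hloc.lt_one_two h1 h2)
    (fun h3 => h.lt_two_three hloc h2 h3)
  obtain ⟨z₁, z₃, z₄, n1, n3, n4, hr, hf⟩ := h.exists_relations_second hz
  exact hf (f1 z₁ n1 fun _ => by linear_combination hr.mul_eq_one_two) hza
    (f3 z₃ n3 fun h3 => hr.mul_eq_two_three h h2 h3) (mul_sq_lt_sq_of_neg h4 n4)

theorem IsEllipticOI.isFlexible_of_third_pos (h : M.IsEllipticOI) (hloc : M.LocalExistence)
    (h3 : 0 < M.mu 3) (h1 : M.mu 1 < 0) : M.IsFlexible := by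
  obtain ⟨z, hz, hza, f2, f4⟩ := exists_mul_sq_lt_sq h3 (h.quadCloses_iff 1).1.1
    (h.quadCloses_iff 3).1.1 (fun h2 => by rw [mul_comm]; exact h.lt_two_three hloc h2 h3)
    (fun h4 => hloc.lt_three_four h3 h4)
  obtain ⟨z₁, z₂, z₄, n1, n2, n4, hr, hf⟩ := h.exists_relations_third hz
  exact hf (mul_sq_lt_sq_of_neg h1 n1)
    (f2 z₂ n2 fun h2 => by linear_combination hr.mul_eq_two_three h h2 h3) hza
    (f4 z₄ n4 fun _ => hr.mul_eq_three_four)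

theorem IsEllipticOI.isFlexible_of_fourth_pos (h : M.IsEllipticOI) (hloc : M.LocalExistence)
    (h4 : 0 < M.lam 3) (h2 : M.lam 1 < 0) : M.IsFlexible := by
  obtain ⟨z, hz, hza, f1, f3⟩ := exists_mul_sq_lt_sq h4 (h.quadCloses_iff 1).1.2.1
    (h.quadCloses_iff 3).1.2.1 (fun h1 => h.lt_four_one hloc h4 h1)
    (fun h3 => by rw [mul_comm]; exact hloc.lt_three_four h3 h4)
  obtain ⟨z₁, z₂, z₃, n1, n2, n3, hr, hf⟩ := h.exists_relations_fourth hz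
  exact hf (f1 z₁ n1 fun h1 => hr.mul_eq_four_one h h4 h1) (mul_sq_lt_sq_of_neg h2 n2)
    (f3 z₃ n3 fun _ => by linear_combination hr.mul_eq_three_four) hza

theorem IsEllipticOI.isFlexible_of_pos (h : M.IsEllipticOI) (hloc : M.LocalExistence)
    (h1 : 0 < M.mu 1) (h2 : 0 < M.lam 1) (h3 : 0 < M.mu 3) (h4 : 0 < M.lam 3) :
    M.IsFlexible := by
  have b1 := hloc.lt_one_two h1 h2
  have b2 := h.lt_two_three hloc h2 h3
  have b3 := hloc.lt_three_four h3 h4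
  have b4 := h.lt_four_one hloc h4 h1
  have g1 := fun {z₁ z₂ z₃ z₄} (hr : M.Relations z₁ z₂ z₃ z₄) => hr.mul_eq_one_two
  have g2 := fun {z₁ z₂ z₃ z₄} (hr : M.Relations z₁ z₂ z₃ z₄) => hr.mul_eq_two_three h h2 h3
  have g3 := fun {z₁ z₂ z₃ z₄} (hr : M.Relations z₁ z₂ z₃ z₄) => hr.mul_eq_three_four
  have g4 := fun {z₁ z₂ z₃ z₄} (hr : M.Relations z₁ z₂ z₃ z₄) => hr.mul_eq_four_one h h4 h1
  generalize M.nu 1 / 4 = C₁ at *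
  generalize M.nu 2 / (4 * (M.k2 * M.k3)) = C₂ at *
  generalize M.nu 3 / 4 = C₃ at *
  generalize M.nu 4 / (4 * (M.k4 * M.k1)) = C₄ at *
  have hC₂ : 0 < C₂ ^ 2 := lt_trans (by positivity) b2
  have hC₃ : 0 < C₃ ^ 2 := lt_trans (by positivity) b3
  -- Starting from `w₂ = 1`, the fourth coordinate is `C₃ / C₂` through edge 3 and `C₄ / C₁` through
  -- edge 1.
  have compat : C₁ * C₃ = C₂ * C₄ := by
    obtain ⟨z₁, z₃, z₄, n1, n3, n4, hr, -⟩ := h.exists_relations_second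
      (z := (1, 1)) (fun h => one_ne_zero (congrArg Prod.fst h))
    have r1 := g1 hr
    have r2 := g2 hr
    have r3 := g3 hr
    have r4 := g4 hr
    simp only [mul_one, one_mul] at r1 r2
    have d1 : z₁.2 ≠ 0 := fun h0 => n1 (Prod.ext (by rw [r1, h0, mul_zero]; rfl) h0)
    have d3 : z₃.2 ≠ 0 := fun h0 => n3 (Prod.ext (by rw [r2, h0, mul_zero]; rfl) h0)
    have e3 : C₂ * z₄.1 = C₃ * z₄.2 := mul_left_cancel₀ d3 (by rw [r2] at r3; linear_combination r3)
    have e4 : C₁ * z₄.1 = C₄ * z₄.2 := mul_left_cancel₀ d1 (by rw [r1] at r4; linear_combination r4)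
    by_contra hne
    have hne' : C₁ * C₃ - C₂ * C₄ ≠ 0 := sub_ne_zero.2 hne
    apply n4
    apply Prod.ext
    · refine (mul_eq_zero.1 (?_ : (C₁ * C₃ - C₂ * C₄) * z₄.1 = 0)).resolve_left hne'
      linear_combination C₃ * e4 - C₄ * e3
    · refine (mul_eq_zero.1 (?_ : (C₁ * C₃ - C₂ * C₄) * z₄.2 = 0)).resolve_left hne'
      linear_combination C₂ * e4 - C₁ * e3
  -- For `y = w₂ ^ 2`, edges 2 and 4 give lower bounds, edges 1 and 3 upper bounds. The four
  -- comparisons are the four local existence inequalities, one of them through `compat`.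
  obtain ⟨y, hlo, hhi⟩ := exists_between
    (show max (M.lam 1) (M.lam 3 * C₂ ^ 2 / C₃ ^ 2) < min (C₁ ^ 2 / M.mu 1) (C₂ ^ 2 / M.mu 3) by
      rw [max_lt_iff, lt_min_iff, lt_min_iff, lt_div_iff₀ h1, lt_div_iff₀ h3,
        div_lt_div_iff₀ hC₃ h1, div_lt_div_iff₀ hC₃ h3]
      refine ⟨⟨by linarith, b2⟩, ?_, ?_⟩
      · have := mul_lt_mul_of_pos_right b4 hC₂
        have e : C₁ ^ 2 * C₃ ^ 2 = C₄ ^ 2 * C₂ ^ 2 := by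
          linear_combination (C₁ * C₃ + C₂ * C₄) * compat
        linarith
      · have := mul_lt_mul_of_pos_right b3 hC₂
        linarith)
  obtain ⟨y2, y4⟩ := max_lt_iff.1 hlo
  obtain ⟨y1, y3⟩ := lt_min_iff.1 hhi
  rw [lt_div_iff₀ h1] at y1
  rw [lt_div_iff₀ h3] at y3
  rw [div_lt_iff₀ hC₃] at y4
  have hy : 0 < y := h2.trans y2
  have hsq := sq_sqrt hy.le
  obtain ⟨z₁, z₃, z₄, n1, n3, n4, hr, hf⟩ := h.exists_relations_second
    (z := (√y, 1)) (fun h => one_ne_zero (congrArg Prod.snd h))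
  refine hf (mul_sq_lt_sq_of_mul_eq (z := (√y, 1)) (C := C₁) hy hsq rfl n1
    (by linear_combination g1 hr) (by linarith))
    (by simpa [hsq] using y2)
    (mul_sq_lt_sq_of_mul_eq hy hsq rfl n3 (g2 hr) (by linarith)) ?_
  have r2 := g2 hr
  have r3 := g3 hr
  simp only [mul_one] at r2
  have d3 : z₃.2 ≠ 0 := fun h0 => n3 (Prod.ext ((mul_eq_zero.1 (r2.trans
    (by rw [h0, mul_zero]))).resolve_left (sqrt_pos.2 hy).ne') h0)
  have e4 : C₂ * z₄.1 = √y * C₃ * z₄.2 :=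
    mul_left_cancel₀ d3 (by linear_combination √y * r3 - z₄.1 * r2)
  have e5 : C₂ ^ 2 * z₄.1 ^ 2 = y * C₃ ^ 2 * z₄.2 ^ 2 := by
    linear_combination (C₂ * z₄.1 + √y * C₃ * z₄.2) * e4 + C₃ ^ 2 * z₄.2 ^ 2 * hsq
  have d4 : z₄.2 ≠ 0 := by
    intro h0
    rw [h0] at e5
    have : z₄.1 ^ 2 = 0 := (mul_eq_zero.1 (e5.trans (by ring))).resolve_left hC₂.ne'
    exact n4 (Prod.ext (by simpa using this) h0)
  have d4' : 0 < z₄.2 ^ 2 := by positivity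
  refine lt_of_mul_lt_mul_left ?_ hC₂.le
  rw [e5]
  have := mul_lt_mul_of_pos_right y4 d4'
  linarith

/-- Edges 2 and 4 impose nothing, while edges 1 and 3 each become an open arc at edge 2. -/
theorem IsEllipticOI.isFlexible_of_mu_pos (h : M.IsEllipticOI) (h1 : 0 < M.mu 1)
    (h3 : 0 < M.mu 3) (h2 : M.lam 1 < 0) (h4 : M.lam 3 < 0)
    (ht : M.tNum 2 = 0 ∨ 16 * √(M.mu 1 * M.mu 2) - |M.nu 1 * M.nu 2| <
      (4 * |M.nu 2| * √(M.mu 1) + 4 * |M.nu 1| * √(M.mu 2)) / |M.tNum 2| * |M.tDen 2|) :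
    M.IsFlexible := by
  obtain ⟨k2, -, t2, -⟩ := h.coupling_two
  obtain ⟨k3, em, t3, -⟩ := h.coupling_three
  have hm2 : 0 < M.mu 2 := by rw [em]; positivity
  have hν1 := abs_pos.2 (h.quadCloses_iff 1).1.2.2
  have hν2 := abs_pos.2 (h.quadCloses_iff 2).1.2.2
  have s3 := tNum_eq_zero_of_pos t3 h3
  have c3 := tDen_ne_zero_of_tNum_eq_zero s3
  obtain ⟨z, hz, hz1, hz3⟩ : ∃ z : ℝ × ℝ, z ≠ 0 ∧ 4 * √(M.mu 1) * |z.1| < |M.nu 1| * |z.2| ∧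
      4 * √(M.mu 2) * |M.k2 * (M.tDen 2 * z.1 + M.tNum 2 * z.2)| <
        |M.nu 2| * |M.tDen 2 * z.2 - M.tNum 2 * z.1| := by
    by_cases h0 : M.tNum 2 = 0
    -- Without rotation both arcs are centered at `w = 0`.
    · refine ⟨(0, 1), fun h => one_ne_zero (congrArg Prod.snd h), ?_, ?_⟩
      · simpa using hν1
      · have := tDen_ne_zero_of_tNum_eq_zero h0
        rw [h0]
        simp
        positivity
    · have hlt := ht.resolve_left h0
      rw [(t2 h0).1]
      simp only [one_mul]
      apply exists_mem_arcs (by positivity) (by positivity) hν1 hν2 h0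
      rw [sqrt_mul h1.le, abs_mul, div_mul_eq_mul_div, lt_div_iff₀ (abs_pos.2 h0)] at hlt
      linarith
  obtain ⟨z₁, z₃, z₄, n1, n3, n4, hr, hf⟩ := h.exists_relations_second hz
  refine hf (mul_sq_lt_sq_of_relation h1 n1 hr.1 hz1) (mul_sq_lt_sq_of_neg h2 hz) ?_
    (mul_sq_lt_sq_of_neg h4 n4)
  have r2 := hr.2.1
  rw [s3] at r2
  -- `Q₂` sees the third coordinate after the coupling, scaled by `k3` and with threshold `mu 2 = k3
  -- ^ 2 * mu 3`.
  have := mul_sq_lt_sq_of_relation (n := M.k3 * z₃.1) (d := z₃.2) hm2 (fun h0 => n3 (Prod.ext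
    ((mul_eq_zero.1 (Prod.mk_eq_zero.1 h0).1).resolve_left k3) (Prod.mk_eq_zero.1 h0).2))
    (mul_left_cancel₀ c3 (by linear_combination r2)) hz3
  rw [em] at this
  have hk3 : 0 < M.k3 ^ 2 := by positivity
  refine lt_of_mul_lt_mul_left ?_ hk3.le
  linarith

/-- Here the constrained edges are 2 and 4, so the two arcs are compared at edge 3, between them. -/
theorem IsEllipticOI.isFlexible_of_lam_pos (h : M.IsEllipticOI) (h2 : 0 < M.lam 1)
    (h4 : 0 < M.lam 3) (h1 : M.mu 1 < 0) (h3 : M.mu 3 < 0)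
    (ht : M.tNum 3 = 0 ∨ 16 * √(M.lam 2 * M.lam 3) - |M.nu 2 * M.nu 3| <
      (4 * |M.nu 3| * √(M.lam 2) + 4 * |M.nu 2| * √(M.lam 3)) / |M.tNum 3| * |M.tDen 3|) :
    M.IsFlexible := by
  obtain ⟨k2, el, t2, -⟩ := h.coupling_two
  obtain ⟨k3, -, t3, -⟩ := h.coupling_three
  have hl2 : 0 < M.lam 2 := by rw [el]; positivity
  have hν3 := abs_pos.2 (h.quadCloses_iff 3).1.2.2
  have hν2 := abs_pos.2 (h.quadCloses_iff 2).1.2.2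
  have s2 := tNum_eq_zero_of_pos t2 h2
  have c2 := tDen_ne_zero_of_tNum_eq_zero s2
  obtain ⟨z, hz, hz4, hz2⟩ : ∃ z : ℝ × ℝ, z ≠ 0 ∧ 4 * √(M.lam 3) * |z.1| < |M.nu 3| * |z.2| ∧
      4 * √(M.lam 2) * |M.k3 * (M.tDen 3 * z.1 + M.tNum 3 * z.2)| <
        |M.nu 2| * |M.tDen 3 * z.2 - M.tNum 3 * z.1| := by
    by_cases h0 : M.tNum 3 = 0
    · refine ⟨(0, 1), fun h => one_ne_zero (congrArg Prod.snd h), ?_, ?_⟩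
      · simpa using hν3
      · have := tDen_ne_zero_of_tNum_eq_zero h0
        rw [h0]
        simp
        positivity
    · have hlt := ht.resolve_left h0
      rw [(t3 h0).1]
      simp only [one_mul]
      apply exists_mem_arcs (by positivity) (by positivity) hν3 hν2 h0
      rw [sqrt_mul hl2.le, abs_mul, div_mul_eq_mul_div, lt_div_iff₀ (abs_pos.2 h0)] at hlt
      linarith
  obtain ⟨z₁, z₂, z₄, n1, n2, n4, hr, hf⟩ := h.exists_relations_third hz
  refine hf (mul_sq_lt_sq_of_neg h1 n1) ?_ (mul_sq_lt_sq_of_neg h3 hz)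
    (mul_sq_lt_sq_of_relation h4 n4 (by linear_combination hr.2.2.1) hz4)
  have r2 := hr.2.1
  rw [s2] at r2
  have := mul_sq_lt_sq_of_relation (n := M.k2 * z₂.1) (d := z₂.2) hl2 (fun h0 => n2 (Prod.ext
    ((mul_eq_zero.1 (Prod.mk_eq_zero.1 h0).1).resolve_left k2) (Prod.mk_eq_zero.1 h0).2))
    (mul_left_cancel₀ c2 (by linear_combination r2)) hz2
  rw [el] at this
  have hk2 : 0 < M.k2 ^ 2 := by positivity
  refine lt_of_mul_lt_mul_left ?_ hk2.le
  linarith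

end SkewKokotsakisMesh

/-! ### Assembling the sign patterns. -/

theorem theorem1 (M : SkewKokotsakisMesh) (hOI : M.IsEllipticOI) (hloc : M.LocalExistence) :
    M.IsFlexible ↔
      ((∀ i, M.lam i < 0 ∧ 0 < M.mu i) ∧
        (M.tNum 2 = 0 ∨
          16 * √(M.mu 1 * M.mu 2) - |M.nu 1 * M.nu 2| <
            (4 * |M.nu 2| * √(M.mu 1) + 4 * |M.nu 1| * √(M.mu 2)) /
              |M.tNum 2| * |M.tDen 2|)) ∨
      ((∀ i, 0 < M.lam i ∧ M.mu i < 0) ∧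
        (M.tNum 3 = 0 ∨
          16 * √(M.lam 2 * M.lam 3) - |M.nu 2 * M.nu 3| <
            (4 * |M.nu 3| * √(M.lam 2) + 4 * |M.nu 2| * √(M.lam 3)) /
              |M.tNum 3| * |M.tDen 3|)) ∨
      (¬ (∀ i, M.lam i < 0 ∧ 0 < M.mu i) ∧ ¬ (∀ i, 0 < M.lam i ∧ M.mu i < 0)) := by
  constructor
  · intro hflex
    by_cases hA : ∀ i, M.lam i < 0 ∧ 0 < M.mu i
    · refine Or.inl ⟨hA, ?_⟩
      by_contra! h
      exact hOI.not_isFlexible_of_mu_pos (hA 1).2 (hA 2).2 h.1 h.2 hflex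
    · by_cases hB : ∀ i, 0 < M.lam i ∧ M.mu i < 0
      · refine Or.inr (Or.inl ⟨hB, ?_⟩)
        by_contra! h
        exact hOI.not_isFlexible_of_lam_pos (hB 2).1 (hB 3).1 h.1 h.2 hflex
      · exact Or.inr (Or.inr ⟨hA, hB⟩)
  · rintro (⟨hA, ht⟩ | ⟨hB, ht⟩ | ⟨hA, hB⟩)
    · exact hOI.isFlexible_of_mu_pos (hA 1).2 (hA 3).2 (hA 1).1 (hA 3).1 ht
    · exact hOI.isFlexible_of_lam_pos (hB 1).1 (hB 3).1 (hB 1).2 (hB 3).2 ht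
    · obtain ⟨k1, e1, -⟩ := hOI.coupling_one
      obtain ⟨k2, e2, -⟩ := hOI.coupling_two
      obtain ⟨k3, e3, -⟩ := hOI.coupling_three
      obtain ⟨k4, e4, -⟩ := hOI.coupling_four
      -- The couplings rescale thresholds by these positive squares, so the signs of `mu 1`, `lam
      -- 1`, `mu 3`, `lam 3` determine all eight.
      have hk1 : 0 < M.k1 ^ 2 := by positivity
      have hk2 : 0 < M.k2 ^ 2 := by positivity
      have hk3 : 0 < M.k3 ^ 2 := by positivity
      have hk4 : 0 < M.k4 ^ 2 := by positivity
      rcases (hOI.quadCloses_iff 1).1.2.1.lt_or_gt with h1 | h1 <;>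
      rcases (hOI.quadCloses_iff 3).1.2.1.lt_or_gt with h3 | h3
      · rcases (hOI.quadCloses_iff 1).1.1.lt_or_gt with h2 | h2 <;>
        rcases (hOI.quadCloses_iff 3).1.1.lt_or_gt with h4 | h4
        · exact hOI.isFlexible_of_neg h1 h3 h4
        · exact hOI.isFlexible_of_fourth_pos hloc h4 h2
        · exact hOI.isFlexible_of_second_pos hloc h2 h4
        · exact absurd (SkewKokotsakisMesh.forall_zmod_four ⟨h2, h1⟩
            ⟨by rw [e2]; positivity, by rw [e3]; exact mul_neg_of_pos_of_neg hk3 h3⟩ ⟨h4, h3⟩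
            ⟨by rw [e4]; positivity, by rw [e1]; exact mul_neg_of_pos_of_neg hk1 h1⟩) hB
      · exact hOI.isFlexible_of_third_pos hloc h3 h1
      · exact hOI.isFlexible_of_first_pos hloc h1 h3
      · rcases (hOI.quadCloses_iff 1).1.1.lt_or_gt with h2 | h2 <;>
        rcases (hOI.quadCloses_iff 3).1.1.lt_or_gt with h4 | h4
        · exact absurd (SkewKokotsakisMesh.forall_zmod_four ⟨h2, h1⟩
            ⟨by rw [e2]; exact mul_neg_of_pos_of_neg hk2 h2, by rw [e3]; positivity⟩ ⟨h4, h3⟩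
            ⟨by rw [e4]; exact mul_neg_of_pos_of_neg hk4 h4, by rw [e1]; positivity⟩) hA
        · exact hOI.isFlexible_of_fourth_pos hloc h4 h2
        · exact hOI.isFlexible_of_second_pos hloc h2 h4
        · exact hOI.isFlexible_of_pos hloc h1 h2 h3 h4
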